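/- Let $n,m\in\mathbb{Z}$ with $2\leq n\leq |m|$, let $\Gamma=\operatorname{BS}(n,m)=\langle a,b\mid ba^nb^{-1}=a^m\rangle$, and for $g\in\Gamma$ put $l(g)=[\langle a\rangle:\langle a\rangle\cap g^{-1}\langle a\rangle g]$. Let $(P,\tau)$ be a tracial von Neumann algebra, i.e. a von Neumann algebra with a faithful normal tracial state, and let $\Gamma\curvearrowright P$ be a trace preserving action by $*$-automorphisms such that, for every $g\in\Gamma$, the inclusion $P\rtimes\langle a^{l(g)}\rangle\subset P\rtimes\Gamma$ is irreducible, i.e. $(P\rtimes\langle a^{l(g)}\rangle)'\cap(P\rtimes\Gamma)=\mathbb{C}1$. Write $M:=P\rtimes\Gamma$, with its canonical faithful normal trace and canonical unitaries $(u_g)_{g\in\Gamma}$, and $N:=P\rtimes\langle a\rangle\subset M$. For $g\in\Gamma$ let $\mathcal{K}_g:=\overline{\operatorname{span}}^{\|\cdot\|_2}\,Nu_gN\subset L^2(M)$, regarded as an $N$-$N$-bimodule. Then 1. for every $g\in\Gamma$ the $N$-$N$-bimodule $\mathcal{K}_g$ is irreducible, i.e. it is nonzero and its only closed $N$-$N$-subbimodules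 are $\{0\}$ and $\mathcal{K}_g$; 2. for all $g,h\in\Gamma$, the $N$-$N$-bimodules $\mathcal{K}_g$ and $\mathcal{K}_h$ are isomorphic (there is a unitary $\mathcal{K}_g\to\mathcal{K}_h$ commuting with the left and right actions of $N$) if and only if $\langle a\rangle g\langle a\rangle=\langle a\rangle h\langle a\rangle$. -/

import Mathlib

open scoped ComplexOrder InnerProductSpace ENNReal

noncomputable section

universe u v

/-! ## The von Neumann algebra generated by a set of operators -/

namespace VonNeumannAlgebra

variable {H : Type u} [NormedAddCommGroup H] [InnerProductSpace ℂ H] [CompleteSpace H]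

/-- The von Neumann algebra generated by a set `S` of bounded operators: the double commutant of
`S ∪ S*` (`StarSubalgebra.centralizer` is the commutant of a set together with its adjoints). -/
def generatedBy (S : Set (H →L[ℂ] H)) : VonNeumannAlgebra H :=
  commutant
    { toStarSubalgebra := StarSubalgebra.centralizer ℂ S
      centralizer_centralizer' := by simp }

theorem mem_generatedBy_iff {S : Set (H →L[ℂ] H)} {x : H →L[ℂ] H} :
    x ∈ generatedBy S ↔ ∀ y : H →L[ℂ] H,
      (∀ s ∈ S, s * y = y * s ∧ star s * y = y * star s) → y * x = x * y := by
  unfold generatedBy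
  rw [mem_commutant_iff]
  exact forall_congr' fun y => imp_congr_left (StarSubalgebra.mem_centralizer_iff ℂ)

theorem subset_generatedBy (S : Set (H →L[ℂ] H)) {x : H →L[ℂ] H} (hx : x ∈ S) :
    x ∈ generatedBy S :=
  mem_generatedBy_iff.2 fun _ hy => (hy x hx).1.symm

theorem generatedBy_mono {S T : Set (H →L[ℂ] H)} (h : S ⊆ T) : generatedBy S ≤ generatedBy T :=
  fun _ hx => mem_generatedBy_iff.2 fun y hy => mem_generatedBy_iff.1 hx y fun s hs => hy s (h hs)

/-- An inclusion `A ⊆ B` of von Neumann algebras is irreducible if the relative commutant of `A` in `B` is `ℂ 1`. -/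
def IsIrreducibleIn (A B : VonNeumannAlgebra H) : Prop :=
  A ≤ B ∧ ∀ x ∈ B, (∀ a ∈ A, a * x = x * a) → ∃ c : ℂ, x = c • 1

end VonNeumannAlgebra

/-! ## Tracial von Neumann algebras and their standard bimodule -/

/-- A von Neumann algebra on `H` equipped with a faithful normal tracial state. Normality is
`σ`-weak continuity, i.e. `τ = ∑ ⟪η i, · ξ i⟫` for square summable sequences of vectors. -/
structure TracialVNA (H : Type u) [NormedAddCommGroup H] [InnerProductSpace ℂ H]
    [CompleteSpace H] where
  alg : VonNeumannAlgebra H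
  trace : alg.toStarSubalgebra →ₗ[ℂ] ℂ
  trace_one : trace 1 = 1
  trace_nonneg : ∀ x, 0 ≤ trace (star x * x)
  faithful : ∀ x, trace (star x * x) = 0 → x = 0
  tracial : ∀ x y, trace (x * y) = trace (y * x)
  normal : ∃ ξ η : ℕ → H, (Summable fun i => ‖ξ i‖ ^ 2) ∧ (Summable fun i => ‖η i‖ ^ 2) ∧
    ∀ x : alg.toStarSubalgebra,
      HasSum (fun i => ⟪η i, (x : H →L[ℂ] H) (ξ i)⟫_ℂ) (trace x)

theorem exists_sub_eq_star_mul_self {A : Type u} [CStarAlgebra A] (x : A) :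
    ∃ z : A, ((‖x‖ ^ 2 : ℝ) : ℂ) • (1 : A) - star x * x = star z * z := by
  let _ : PartialOrder A := CStarAlgebra.spectralOrder A
  have : StarOrderedRing A := CStarAlgebra.spectralOrderedRing A
  have h := CStarAlgebra.star_mul_le_algebraMap_norm_sq (a := x)
  obtain ⟨z, hz⟩ := CStarAlgebra.nonneg_iff_eq_star_mul_self.1 (sub_nonneg.2 h)
  refine ⟨z, ?_⟩
  rw [← hz, Algebra.algebraMap_eq_smul_one, Complex.coe_smul]

namespace TracialVNA

variable {H : Type u} [NormedAddCommGroup H] [InnerProductSpace ℂ H] [CompleteSpace H]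
variable (T : TracialVNA H)

/-- The elements of a tracial von Neumann algebra. -/
abbrev Elt : Type u := T.alg.toStarSubalgebra

theorem isClosed_alg : IsClosed (T.alg.toStarSubalgebra : Set (H →L[ℂ] H)) := by
  have h := T.alg.centralizer_centralizer'
  change IsClosed T.alg.carrier
  rw [← h]
  exact Set.isClosed_centralizer _

instance : CompleteSpace T.Elt := T.isClosed_alg.completeSpace_coe

instance : CStarAlgebra T.Elt where

theorem exists_star_mul_self (x : T.Elt) :
    ∃ z : T.Elt, ((‖x‖ ^ 2 : ℝ) : ℂ) • (1 : T.Elt) - star x * x = star z * z :=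
  exists_sub_eq_star_mul_self x

/-- The trace is hermitian. -/
theorem trace_star (x : T.Elt) : T.trace (star x) = star (T.trace x) := by
  have h1 := T.trace_nonneg (1 + x)
  have h2 := T.trace_nonneg (1 + Complex.I • x)
  have h3 := T.trace_nonneg x
  have h0 := T.trace_one
  simp only [star_add, star_one, star_smul, mul_add, add_mul, one_mul, mul_one, map_add,
    smul_mul_assoc, mul_smul_comm, map_smul, smul_eq_mul, Complex.star_def, Complex.conj_I,
    h0] at h1 h2
  have e1 := (Complex.nonneg_iff.1 h1).2
  have e2 := (Complex.nonneg_iff.1 h2).2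
  have e3 := (Complex.nonneg_iff.1 h3).2
  simp at e1 e2 e3
  apply Complex.ext <;> simp <;> linarith

/-- The algebra `T`, regarded as the pre-Hilbert space with `⟪x, y⟫ = τ(x* y)`. -/
def PreL2 : Type u := T.Elt

instance : AddCommGroup T.PreL2 := inferInstanceAs (AddCommGroup T.Elt)
instance : Module ℂ T.PreL2 := inferInstanceAs (Module ℂ T.Elt)

/-- The identity map from `T` to its pre-Hilbert space. -/
def toPreL2 : T.Elt ≃ₗ[ℂ] T.PreL2 := LinearEquiv.refl ℂ _

/-- The inner product `⟪x, y⟫ = τ(x* y)`. -/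
abbrev innerCore : InnerProductSpace.Core ℂ T.PreL2 where
  inner x y := T.trace (star (T.toPreL2.symm x) * T.toPreL2.symm y)
  conj_inner_symm x y := by
    rw [← Complex.star_def, ← T.trace_star]
    simp
  re_inner_nonneg x := (RCLike.nonneg_iff.1 (T.trace_nonneg _)).1
  add_left x y z := by rw [map_add, star_add, add_mul, map_add]
  smul_left x y r := by simp
  definite x h := T.toPreL2.symm.map_eq_zero_iff.1 (T.faithful _ h)

instance : NormedAddCommGroup T.PreL2 :=
  InnerProductSpace.Core.toNormedAddCommGroup (cd := T.innerCore)
instance : InnerProductSpace ℂ T.PreL2 := InnerProductSpace.ofCore T.innerCore.toCore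

/-- The Hilbert space `L²(T, τ)`: the completion of `T` for `⟪x, y⟫ = τ(x* y)`. -/
abbrev L2 : Type u := UniformSpace.Completion T.PreL2

/-- The vector `x̂` of `L²(T, τ)` given by `x ∈ T`. -/
def hat (x : T.Elt) : T.L2 := ((T.toPreL2 x : T.PreL2) : T.L2)

theorem inner_toPreL2 (x y : T.Elt) :
    ⟪T.toPreL2 x, T.toPreL2 y⟫_ℂ = T.trace (star x * y) := rfl

theorem inner_hat (x y : T.Elt) : ⟪T.hat x, T.hat y⟫_ℂ = T.trace (star x * y) := by
  unfold hat
  rw [UniformSpace.Completion.inner_coe, inner_toPreL2]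

theorem norm_sq_toPreL2 (x : T.Elt) :
    ((‖T.toPreL2 x‖ ^ 2 : ℝ) : ℂ) = T.trace (star x * x) := by
  rw [← inner_toPreL2, inner_self_eq_norm_sq_to_K]; simp

theorem norm_toPreL2_mul_le (x y : T.Elt) :
    ‖T.toPreL2 (x * y)‖ ≤ ‖x‖ * ‖T.toPreL2 y‖ := by
  obtain ⟨z, hz⟩ := T.exists_star_mul_self x
  have h := T.trace_nonneg (z * y)
  have e : star (z * y) * (z * y) = ((‖x‖ ^ 2 : ℝ) : ℂ) • (star y * y) - star (x * y) * (x * y) := by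
    calc _ = star y * (star z * z) * y := by simp [mul_assoc]
      _ = _ := by rw [← hz]; simp [mul_sub, sub_mul, mul_assoc]
  rw [e, map_sub, map_smul, ← norm_sq_toPreL2, ← norm_sq_toPreL2, smul_eq_mul,
    ← Complex.ofReal_mul, ← Complex.ofReal_sub, Complex.zero_le_real] at h
  refine le_of_sq_le_sq ?_ (by positivity)
  rw [mul_pow]; linarith

theorem norm_toPreL2_star (x : T.Elt) : ‖T.toPreL2 (star x)‖ = ‖T.toPreL2 x‖ := by
  have : ((‖T.toPreL2 (star x)‖ ^ 2 : ℝ) : ℂ) = ((‖T.toPreL2 x‖ ^ 2 : ℝ) : ℂ) := by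
    rw [norm_sq_toPreL2, norm_sq_toPreL2, star_star, T.tracial]
  exact (sq_eq_sq₀ (norm_nonneg _) (norm_nonneg _)).1 (Complex.ofReal_injective this)

/-- Left multiplication by `x` on `L²(T, τ)`: the bounded operator with `ŷ ↦ (x y)^`. -/
def leftMul (x : T.Elt) : T.L2 →L[ℂ] T.L2 :=
  ContinuousLinearMap.completion
    ((T.toPreL2.toLinearMap ∘ₗ LinearMap.mulLeft ℂ x ∘ₗ T.toPreL2.symm.toLinearMap).mkContinuous
      ‖x‖ fun y => T.norm_toPreL2_mul_le x (T.toPreL2.symm y))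

/-- Right multiplication by `x` on `L²(T, τ)`: the bounded operator with `ŷ ↦ (y x)^`. -/
def rightMul (x : T.Elt) : T.L2 →L[ℂ] T.L2 :=
  ContinuousLinearMap.completion
    ((T.toPreL2.toLinearMap ∘ₗ LinearMap.mulRight ℂ x ∘ₗ T.toPreL2.symm.toLinearMap).mkContinuous
      ‖x‖ fun y => by
        have h := T.norm_toPreL2_mul_le (star x) (star (T.toPreL2.symm y))
        rw [← star_mul, norm_toPreL2_star, norm_toPreL2_star, norm_star] at h
        exact h)

@[simp] theorem leftMul_hat (x y : T.Elt) : T.leftMul x (T.hat y) = T.hat (x * y) := by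
  simp [leftMul, hat]

@[simp] theorem rightMul_hat (x y : T.Elt) : T.rightMul x (T.hat y) = T.hat (y * x) := by
  simp [rightMul, hat]

theorem denseRange_hat : DenseRange T.hat :=
  (UniformSpace.Completion.denseRange_coe (α := T.PreL2)).comp
    T.toPreL2.surjective.denseRange (UniformSpace.Completion.continuous_coe _)

/-- Bounded operators on `L²(T, τ)` are determined by their values on `T`. -/
theorem clm_ext {E : Type v} [NormedAddCommGroup E] [NormedSpace ℂ E] {f g : T.L2 →L[ℂ] E}
    (h : ∀ x, f (T.hat x) = g (T.hat x)) : f = g :=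
  ContinuousLinearMap.coeFn_injective
    (T.denseRange_hat.equalizer f.continuous g.continuous (funext h))

theorem norm_leftMul_le (x : T.Elt) : ‖T.leftMul x‖ ≤ ‖x‖ := by
  refine ContinuousLinearMap.opNorm_le_bound _ (norm_nonneg _) fun ξ => ?_
  refine T.denseRange_hat.induction_on (p := fun ξ => ‖T.leftMul x ξ‖ ≤ ‖x‖ * ‖ξ‖) ξ ?_ ?_
  · exact isClosed_le (by fun_prop) (by fun_prop)
  · intro y
    rw [leftMul_hat]
    simpa [hat] using T.norm_toPreL2_mul_le x y

@[simp] theorem leftMul_one : T.leftMul 1 = 1 := T.clm_ext fun x => by simp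

theorem leftMul_rightMul_comm (x y : T.Elt) (ξ : T.L2) :
    T.leftMul x (T.rightMul y ξ) = T.rightMul y (T.leftMul x ξ) := by
  have : (T.leftMul x).comp (T.rightMul y) = (T.rightMul y).comp (T.leftMul x) :=
    T.clm_ext fun z => by simp [mul_assoc]
  exact congrArg (fun f : T.L2 →L[ℂ] T.L2 => f ξ) this

theorem adjoint_aux (f g : T.L2 →L[ℂ] T.L2)
    (h : ∀ x y, ⟪f (T.hat x), T.hat y⟫_ℂ = ⟪T.hat x, g (T.hat y)⟫_ℂ) : star f = g := by
  rw [ContinuousLinearMap.star_eq_adjoint, eq_comm, ContinuousLinearMap.eq_adjoint_iff]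
  intro ξ η
  refine T.denseRange_hat.induction_on₂ (p := fun ξ η => ⟪g ξ, η⟫_ℂ = ⟪ξ, f η⟫_ℂ) ?_ ?_ ξ η
  · exact isClosed_eq (by fun_prop) (by fun_prop)
  · intro x y
    rw [← inner_conj_symm, ← h, inner_conj_symm]

theorem star_leftMul (x : T.Elt) : star (T.leftMul x) = T.leftMul (star x) :=
  T.adjoint_aux _ _ fun y z => by simp [inner_hat, mul_assoc]

theorem star_rightMul (x : T.Elt) : star (T.rightMul x) = T.rightMul (star x) :=
  T.adjoint_aux _ _ fun y z => by
    simp only [rightMul_hat, inner_hat, star_mul]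
    rw [mul_assoc, T.tracial, mul_assoc]

end TracialVNA

/-! ## Operators on `ℓ²(Γ, E)` -/

/-- The Hilbert space `ℓ²(Γ, E)`. -/
abbrev EllTwo (Γ : Type v) (E : Type u) [NormedAddCommGroup E] : Type (max u v) :=
  lp (fun _ : Γ => E) 2

namespace EllTwo

variable {Γ : Type v} {E : Type u} [NormedAddCommGroup E]

theorem summable_norm_sq (ξ : EllTwo Γ E) : Summable fun s => ‖ξ s‖ ^ 2 := by
  have := (lp.memℓp ξ).summable (by norm_num)
  simpa using this

theorem norm_sq_eq (ξ : EllTwo Γ E) : ‖ξ‖ ^ 2 = ∑' s, ‖ξ s‖ ^ 2 := by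
  have := lp.norm_rpow_eq_tsum (p := 2) (by norm_num) ξ
  simpa using this

theorem memℓp_two {f : Γ → E} (h : Summable fun s => ‖f s‖ ^ 2) :
    Memℓp f 2 := by
  rw [memℓp_gen_iff (by norm_num)]
  simpa using h

open Classical in
/-- The vector `δ_s ⊗ v` of `ℓ²(Γ, E)`. -/
def delta (s : Γ) (v : E) : EllTwo Γ E := lp.single 2 s v

theorem delta_self (s : Γ) (v : E) : (delta s v : EllTwo Γ E) s = v := by
  simp [delta]

theorem delta_ne {s t : Γ} (h : t ≠ s) (v : E) : (delta s v : EllTwo Γ E) t = 0 := by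
  simp [delta, h]

variable [InnerProductSpace ℂ E]

theorem summable_op (e : Γ ≃ Γ) (S : Γ → E →L[ℂ] E) (C : ℝ) (hS : ∀ s, ‖S s‖ ≤ C)
    (ξ : EllTwo Γ E) : Summable fun s => ‖S s (ξ (e s))‖ ^ 2 := by
  refine Summable.of_nonneg_of_le (fun s => by positivity) (fun s => ?_)
    ((e.summable_iff.2 (summable_norm_sq ξ)).mul_left (C ^ 2))
  have := (S s).le_of_opNorm_le (hS s) (ξ (e s))
  rw [Function.comp_apply, ← mul_pow]
  gcongr

/-- The bounded operator `ξ ↦ (s ↦ S s (ξ (e s)))` on `ℓ²(Γ, E)`, for a permutation `e` of `Γ` and a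
family of operators `S s` on `E` whose norms are bounded by `C`. -/
def op (e : Γ ≃ Γ) (S : Γ → E →L[ℂ] E) (C : ℝ) (hS : ∀ s, ‖S s‖ ≤ C) :
    EllTwo Γ E →L[ℂ] EllTwo Γ E :=
  LinearMap.mkContinuous
    { toFun := fun ξ => ⟨fun s => S s (ξ (e s)), memℓp_two (summable_op e S C hS ξ)⟩
      map_add' := fun ξ η => by ext s; exact map_add (S s) _ _
      map_smul' := fun c ξ => by ext s; simp }
    |C| fun ξ => by
      refine le_of_sq_le_sq ?_ (by positivity)
      rw [mul_pow, norm_sq_eq, norm_sq_eq, ← e.tsum_eq (fun s => ‖ξ s‖ ^ 2), ← tsum_mul_left]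
      refine Summable.tsum_le_tsum (fun s => ?_) (summable_op e S C hS ξ)
        ((e.summable_iff.2 (summable_norm_sq ξ)).mul_left _)
      have := (S s).le_of_opNorm_le ((hS s).trans (le_abs_self C)) (ξ (e s))
      rw [← mul_pow]
      exact pow_le_pow_left₀ (norm_nonneg _) this 2

@[simp] theorem op_apply (e : Γ ≃ Γ) (S : Γ → E →L[ℂ] E) (C : ℝ) (hS : ∀ s, ‖S s‖ ≤ C)
    (ξ : EllTwo Γ E) (s : Γ) : op e S C hS ξ s = S s (ξ (e s)) := rfl

theorem star_op [CompleteSpace E] (e : Γ ≃ Γ) (S : Γ → E →L[ℂ] E) (C : ℝ) (hS : ∀ s, ‖S s‖ ≤ C)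
    (S' : Γ → E →L[ℂ] E) (C' : ℝ) (hS' : ∀ s, ‖S' s‖ ≤ C')
    (h : ∀ s, S' (e s) = star (S s)) :
    star (op e S C hS) = op e.symm S' C' hS' := by
  rw [ContinuousLinearMap.star_eq_adjoint, eq_comm, ContinuousLinearMap.eq_adjoint_iff]
  intro ξ η
  rw [lp.inner_eq_tsum, lp.inner_eq_tsum, ← e.tsum_eq]
  refine tsum_congr fun s => ?_
  simp [h, ContinuousLinearMap.star_eq_adjoint, ContinuousLinearMap.adjoint_inner_left]

theorem mem_of_delta_mem (V : Submodule ℂ (EllTwo Γ E)) (hV : IsClosed (V : Set (EllTwo Γ E)))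
    (h : ∀ s v, delta s v ∈ V) (ξ : EllTwo Γ E) : ξ ∈ V := by
  classical
  have hs := lp.hasSum_single (p := 2) (by norm_num) ξ
  refine hV.mem_of_tendsto hs (Filter.Eventually.of_forall fun F => V.sum_mem fun s _ => ?_)
  have := h s (ξ s)
  unfold delta at this
  convert this

end EllTwo

/-! ## Trace preserving actions and crossed products -/

/-- A trace preserving action of `Γ` on `(P, τ)` by `*`-automorphisms. -/
structure TracePreservingAction (Γ : Type v) [Group Γ] {H : Type u} [NormedAddCommGroup H]
    [InnerProductSpace ℂ H] [CompleteSpace H] (P : TracialVNA H) where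
  aut : Γ →* (P.Elt ≃⋆ₐ[ℂ] P.Elt)
  trace_aut : ∀ g x, P.trace (aut g x) = P.trace x

namespace TracePreservingAction

open EllTwo

variable {Γ : Type v} [Group Γ] {H : Type u} [NormedAddCommGroup H]
  [InnerProductSpace ℂ H] [CompleteSpace H] {P : TracialVNA H} (σ : TracePreservingAction Γ P)

theorem norm_aut (g : Γ) (x : P.Elt) : ‖σ.aut g x‖ = ‖x‖ :=
  StarAlgEquiv.norm_map _ x

@[simp] theorem inv_aut_aut (g : Γ) (x : P.Elt) : (σ.aut g)⁻¹ (σ.aut g x) = x :=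
  (σ.aut g).symm_apply_apply x

@[simp] theorem aut_inv_aut (g : Γ) (x : P.Elt) : σ.aut g ((σ.aut g)⁻¹ x) = x :=
  (σ.aut g).apply_symm_apply x

theorem aut_aut (g h : Γ) (x : P.Elt) : σ.aut g (σ.aut h x) = σ.aut (g * h) x := by
  rw [map_mul]; rfl

/-- The representation of `P` on `ℓ²(Γ, L²(P))`, `(π(x) ξ)(s) = σ_{s⁻¹}(x) ξ(s)`. -/
def rep (x : P.Elt) : EllTwo Γ P.L2 →L[ℂ] EllTwo Γ P.L2 :=
  op (Equiv.refl Γ) (fun s => P.leftMul (σ.aut s⁻¹ x)) ‖x‖ fun s =>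
    (P.norm_leftMul_le _).trans_eq (σ.norm_aut _ _)

/-- The canonical unitaries on `ℓ²(Γ, L²(P))`, `(u_g ξ)(s) = ξ(g⁻¹ s)`. -/
def u (g : Γ) : EllTwo Γ P.L2 →L[ℂ] EllTwo Γ P.L2 :=
  op (Equiv.mulLeft g⁻¹) (fun _ => 1) 1 fun _ => ContinuousLinearMap.norm_id_le

/-- The vector `Ω = δ_e ⊗ 1̂` of `ℓ²(Γ, L²(P))`. -/
def vacuum (Γ : Type v) [Group Γ] (P : TracialVNA H) : EllTwo Γ P.L2 := delta 1 (P.hat 1)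

/-- For a subgroup `Λ` of `Γ`, the von Neumann subalgebra `P ⋊ Λ` of `P ⋊ Γ`, generated by `P`
and the canonical unitaries `u_g`, `g ∈ Λ`. -/
def subCrossed (Λ : Subgroup Γ) : VonNeumannAlgebra (EllTwo Γ P.L2) :=
  VonNeumannAlgebra.generatedBy (Set.range σ.rep ∪ (u (P := P)) '' Λ)

theorem subCrossed_mono {Λ Λ' : Subgroup Γ} (h : Λ ≤ Λ') : σ.subCrossed Λ ≤ σ.subCrossed Λ' :=
  VonNeumannAlgebra.generatedBy_mono (Set.union_subset_union_right _ (Set.image_mono h))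

theorem rep_mem (Λ : Subgroup Γ) (x : P.Elt) : σ.rep x ∈ σ.subCrossed Λ :=
  VonNeumannAlgebra.subset_generatedBy _ (Or.inl ⟨x, rfl⟩)

theorem u_mem {Λ : Subgroup Γ} {g : Γ} (hg : g ∈ Λ) : u g ∈ σ.subCrossed Λ :=
  VonNeumannAlgebra.subset_generatedBy _ (Or.inr ⟨g, hg, rfl⟩)

theorem star_rep (x : P.Elt) : star (σ.rep x) = σ.rep (star x) :=
  star_op _ _ _ _ _ _ _ fun _ => by simp [P.star_leftMul, map_star]

theorem star_u (g : Γ) : star (u (P := P) g) = u g⁻¹ := by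
  unfold u
  rw [star_op (S' := fun _ => 1) (C' := 1)
    (hS' := fun _ => ContinuousLinearMap.norm_id_le) (h := fun _ => by simp)]
  ext ξ s
  simp

/-! The commutant of `P ⋊ Γ` on `ℓ²(Γ, L²(P))` contains the operators `rightRep` and `rightU`
below; this is what makes the vector state of `Ω` a faithful trace. -/

/-- The operators `(ρ(y) ξ)(s) = ξ(s) y`. -/
def rightRep (Γ : Type v) [Group Γ] (y : P.Elt) : EllTwo Γ P.L2 →L[ℂ] EllTwo Γ P.L2 :=
  op (Equiv.refl Γ) (fun _ => P.rightMul y) ‖P.rightMul y‖ fun _ => le_rfl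

theorem norm_toPreL2_aut (g : Γ) (x : P.Elt) :
    ‖P.toPreL2 (σ.aut g x)‖ = ‖P.toPreL2 x‖ := by
  have : ((‖P.toPreL2 (σ.aut g x)‖ ^ 2 : ℝ) : ℂ) = ((‖P.toPreL2 x‖ ^ 2 : ℝ) : ℂ) := by
    rw [P.norm_sq_toPreL2, P.norm_sq_toPreL2, ← map_star, ← map_mul, σ.trace_aut]
  exact (sq_eq_sq₀ (norm_nonneg _) (norm_nonneg _)).1 (Complex.ofReal_injective this)

/-- The extension of `σ_g` to `L²(P)`. -/
def autL2 (g : Γ) : P.L2 →L[ℂ] P.L2 :=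
  ContinuousLinearMap.completion
    ((P.toPreL2.toLinearMap ∘ₗ (σ.aut g).toAlgEquiv.toLinearMap ∘ₗ
      P.toPreL2.symm.toLinearMap).mkContinuous 1 fun y => by
        rw [one_mul]
        exact (σ.norm_toPreL2_aut g (P.toPreL2.symm y)).le)

@[simp] theorem autL2_hat (g : Γ) (x : P.Elt) : σ.autL2 g (P.hat x) = P.hat (σ.aut g x) := by
  simp [autL2, TracialVNA.hat]

theorem norm_autL2_le (g : Γ) : ‖σ.autL2 g‖ ≤ 1 := by
  refine ContinuousLinearMap.opNorm_le_bound _ zero_le_one fun ξ => ?_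
  refine P.denseRange_hat.induction_on (p := fun ξ => ‖σ.autL2 g ξ‖ ≤ 1 * ‖ξ‖) ξ ?_ ?_
  · exact isClosed_le (by fun_prop) (by fun_prop)
  · intro y
    rw [autL2_hat]
    simpa [TracialVNA.hat] using (σ.norm_toPreL2_aut g y).le

theorem star_autL2 (g : Γ) : star (σ.autL2 g) = σ.autL2 g⁻¹ :=
  P.adjoint_aux _ _ fun x y => by
    rw [autL2_hat, autL2_hat, P.inner_hat, P.inner_hat, ← σ.trace_aut g (star x * _),
      map_mul (σ.aut g), map_star (σ.aut g), σ.aut_aut]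
    simp

/-- The operators `(v_g ξ)(s) = σ_g(ξ(s g))`. -/
def rightU (g : Γ) : EllTwo Γ P.L2 →L[ℂ] EllTwo Γ P.L2 :=
  op (Equiv.mulRight g) (fun _ => σ.autL2 g) 1 fun _ => σ.norm_autL2_le g

theorem star_rightRep (y : P.Elt) : star (rightRep Γ y) = rightRep Γ (star y) :=
  star_op _ _ _ _ _ _ _ fun _ => by simp [P.star_rightMul]

theorem star_rightU (g : Γ) : star (σ.rightU g) = σ.rightU g⁻¹ := by
  unfold rightU
  rw [star_op (S' := fun _ => σ.autL2 g⁻¹) (C' := 1)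
    (hS' := fun _ => σ.norm_autL2_le _) (h := fun _ => (σ.star_autL2 g).symm)]
  ext ξ s
  simp

theorem autL2_leftMul (g : Γ) (x : P.Elt) (ξ : P.L2) :
    σ.autL2 g (P.leftMul x ξ) = P.leftMul (σ.aut g x) (σ.autL2 g ξ) := by
  have : (σ.autL2 g).comp (P.leftMul x) = (P.leftMul (σ.aut g x)).comp (σ.autL2 g) :=
    P.clm_ext fun z => by simp
  exact congrArg (fun f : P.L2 →L[ℂ] P.L2 => f ξ) this

/-- Operators commuting with the generators commute with `P ⋊ Γ`. -/
theorem comm_of_comm {y : EllTwo Γ P.L2 →L[ℂ] EllTwo Γ P.L2}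
    (h1 : ∀ x, σ.rep x * y = y * σ.rep x) (h2 : ∀ g, u g * y = y * u g)
    {Λ : Subgroup Γ} {x : EllTwo Γ P.L2 →L[ℂ] EllTwo Γ P.L2} (hx : x ∈ σ.subCrossed Λ) :
    y * x = x * y := by
  refine VonNeumannAlgebra.mem_generatedBy_iff.1 hx y ?_
  rintro _ (⟨z, rfl⟩ | ⟨g, -, rfl⟩)
  · exact ⟨h1 z, by rw [star_rep, h1]⟩
  · exact ⟨h2 g, by rw [star_u, h2]⟩

theorem rightRep_comm (y : P.Elt) {Λ : Subgroup Γ} {x : EllTwo Γ P.L2 →L[ℂ] EllTwo Γ P.L2}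
    (hx : x ∈ σ.subCrossed Λ) : rightRep Γ y * x = x * rightRep Γ y := by
  refine σ.comm_of_comm (fun z => ?_) (fun g => ?_) hx
  · ext ξ s
    simp [rep, rightRep, P.leftMul_rightMul_comm]
  · ext ξ s
    simp [u, rightRep]

theorem rightU_comm (h : Γ) {Λ : Subgroup Γ} {x : EllTwo Γ P.L2 →L[ℂ] EllTwo Γ P.L2}
    (hx : x ∈ σ.subCrossed Λ) : σ.rightU h * x = x * σ.rightU h := by
  refine σ.comm_of_comm (fun z => ?_) (fun g => ?_) hx
  · ext ξ s
    simp [rep, rightU, autL2_leftMul]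
  · ext ξ s
    simp [u, rightU, mul_assoc]

theorem rep_delta (x y : P.Elt) (s : Γ) :
    σ.rep x (delta s (P.hat y)) = delta s (P.hat (σ.aut s⁻¹ x * y)) := by
  ext t
  by_cases h : t = s
  · subst h; simp [rep, delta_self]
  · simp [rep, delta_ne h]

theorem u_delta (g s : Γ) (v : P.L2) : u g (delta s v) = delta (g * s) v := by
  ext t
  by_cases h : t = g * s
  · subst h; simp [u, delta_self]
  · have h' : g⁻¹ * t ≠ s := fun e => h (by rw [← e]; simp)
    simp [u, delta_ne h, delta_ne h']

theorem rightRep_delta (x y : P.Elt) (s : Γ) :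
    rightRep Γ x (delta s (P.hat y)) = delta s (P.hat (y * x)) := by
  ext t
  by_cases h : t = s
  · subst h; simp [rightRep, delta_self]
  · simp [rightRep, delta_ne h]

theorem rightU_delta (g s : Γ) (y : P.Elt) :
    σ.rightU g (delta s (P.hat y)) = delta (s * g⁻¹) (P.hat (σ.aut g y)) := by
  ext t
  by_cases h : t = s * g⁻¹
  · subst h; simp [rightU, delta_self]
  · have h' : t * g ≠ s := fun e => h (by rw [← e]; simp)
    simp [rightU, delta_ne h, delta_ne h']

theorem mem_of_hat_mem (V : Submodule ℂ (EllTwo Γ P.L2))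
    (hV : IsClosed (V : Set (EllTwo Γ P.L2))) (h : ∀ s x, delta s (P.hat x) ∈ V)
    (ξ : EllTwo Γ P.L2) : ξ ∈ V := by
  classical
  refine mem_of_delta_mem V hV (fun s v => ?_) ξ
  have hc : Continuous fun v : P.L2 => (delta s v : EllTwo Γ P.L2) :=
    (lp.isometry_single (E := fun _ : Γ => P.L2) (p := 2) s).continuous.congr fun v => by
      unfold delta; congr
  exact P.denseRange_hat.induction_on (p := fun v => delta s v ∈ V) v (hV.preimage hc)
    fun x => h s x

/-- `Ω` is separating for `P ⋊ Γ`. -/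
theorem eq_zero_of_apply_vacuum {Λ : Subgroup Γ} {x : EllTwo Γ P.L2 →L[ℂ] EllTwo Γ P.L2}
    (hx : x ∈ σ.subCrossed Λ) (h : x (vacuum Γ P) = 0) : x = 0 := by
  ext1 ξ
  refine mem_of_hat_mem (LinearMap.ker x.toLinearMap) x.isClosed_ker (fun s y => ?_) ξ
  have e : delta s (P.hat y) = rightRep Γ y (σ.rightU s⁻¹ (vacuum Γ P)) := by
    simp [vacuum, rightU_delta, rightRep_delta]
  have c : ∀ η, x (rightRep Γ y (σ.rightU s⁻¹ η)) = rightRep Γ y (σ.rightU s⁻¹ (x η)) := by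
    intro η
    have h1 := congrArg (fun f => f (σ.rightU s⁻¹ η)) (σ.rightRep_comm y hx)
    have h2 := congrArg (fun f => f η) (σ.rightU_comm s⁻¹ hx)
    simp only [mul_apply_eq_comp] at h1 h2
    rw [← h1, ← h2]
  rw [LinearMap.mem_ker, ContinuousLinearMap.coe_coe, e, c, h, map_zero, map_zero]

/-- For `x` in `P ⋊ Γ` and a generator `y = π(p) u_g`, the vector state of `Ω` satisfies
`τ(x y) = τ(y x)`. -/
theorem inner_generator {Λ : Subgroup Γ} {x : EllTwo Γ P.L2 →L[ℂ] EllTwo Γ P.L2}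
    (hx : x ∈ σ.subCrossed Λ) (p : P.Elt) (g : Γ) :
    ⟪vacuum Γ P, x ((σ.rep p * u (P := P) g) (vacuum Γ P))⟫_ℂ =
      ⟪star (σ.rep p * u (P := P) g) (vacuum Γ P), x (vacuum Γ P)⟫_ℂ := by
  have e1 : (σ.rep p * u (P := P) g) (vacuum Γ P) = σ.rightU g⁻¹ (rightRep Γ p (vacuum Γ P)) := by
    simp [vacuum, rightU_delta, rightRep_delta, u_delta, rep_delta]
  have e2 : star (σ.rep p * u (P := P) g) (vacuum Γ P) =
      star (σ.rightU g⁻¹ * rightRep Γ p) (vacuum Γ P) := by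
    simp [vacuum, star_mul, star_rep, star_u, star_rightU, star_rightRep, rightU_delta,
      rightRep_delta, u_delta, rep_delta]
  have c : x ((σ.rightU g⁻¹ * rightRep Γ p) (vacuum Γ P)) =
      (σ.rightU g⁻¹ * rightRep Γ p) (x (vacuum Γ P)) := by
    have h1 := congrArg (fun f => f (vacuum Γ P)) (σ.rightRep_comm p hx)
    have h2 := congrArg (fun f => f (rightRep Γ p (vacuum Γ P))) (σ.rightU_comm g⁻¹ hx)
    simp only [mul_apply_eq_comp] at h1 h2 ⊢
    rw [← h2, h1]
  rw [e1, e2]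
  change ⟪_, x ((σ.rightU g⁻¹ * rightRep Γ p) (vacuum Γ P))⟫_ℂ = _
  rw [c, ContinuousLinearMap.star_eq_adjoint, ContinuousLinearMap.adjoint_inner_left]

/-- The vectors `y Ω`, with `y` in the linear span of the `π(p) u_g`, are dense. -/
theorem vacuum_cyclic (ξ : EllTwo Γ P.L2) :
    ξ ∈ closure ((fun y => y (vacuum Γ P)) ''
      (Submodule.span ℂ (Set.range fun q : P.Elt × Γ => σ.rep q.1 * u q.2) :
        Set (EllTwo Γ P.L2 →L[ℂ] EllTwo Γ P.L2))) := by
  let ev : (EllTwo Γ P.L2 →L[ℂ] EllTwo Γ P.L2) →ₗ[ℂ] EllTwo Γ P.L2 :=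
    { toFun := fun y => y (vacuum Γ P), map_add' := fun _ _ => rfl, map_smul' := fun _ _ => rfl }
  let V := ((Submodule.span ℂ (Set.range fun q : P.Elt × Γ => σ.rep q.1 * u q.2)).map
    ev).topologicalClosure
  refine mem_of_hat_mem V (Submodule.isClosed_topologicalClosure _) (fun s x => ?_) ξ
  refine Submodule.le_topologicalClosure _ ⟨_, Submodule.subset_span ⟨(σ.aut s x, s), rfl⟩, ?_⟩
  simp [ev, vacuum, u_delta, rep_delta]

theorem generator_mem (p : P.Elt) (g : Γ) : σ.rep p * u g ∈ σ.subCrossed ⊤ :=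
  mul_mem (σ.rep_mem _ p) (σ.u_mem (Subgroup.mem_top g))

theorem span_spec {z : EllTwo Γ P.L2 →L[ℂ] EllTwo Γ P.L2}
    (hz : z ∈ Submodule.span ℂ (Set.range fun q : P.Elt × Γ => σ.rep q.1 * u q.2)) :
    z ∈ σ.subCrossed ⊤ ∧ ∀ x ∈ σ.subCrossed (⊤ : Subgroup Γ),
      ⟪vacuum Γ P, x (z (vacuum Γ P))⟫_ℂ = ⟪star z (vacuum Γ P), x (vacuum Γ P)⟫_ℂ := by
  induction hz using Submodule.span_induction with
  | mem z hz =>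
    obtain ⟨q, rfl⟩ := hz
    exact ⟨σ.generator_mem _ _, fun x hx => σ.inner_generator hx _ _⟩
  | zero => exact ⟨zero_mem _, fun x _ => by simp⟩
  | add y z _ _ hy hz =>
    refine ⟨add_mem hy.1 hz.1, fun x hx => ?_⟩
    simp [hy.2 x hx, hz.2 x hx]
  | smul c z _ hz =>
    refine ⟨(σ.subCrossed ⊤).toStarSubalgebra.smul_mem hz.1 c, fun x hx => ?_⟩
    simp [hz.2 x hx, mul_comm]

theorem norm_star_apply_vacuum_le {d : EllTwo Γ P.L2 →L[ℂ] EllTwo Γ P.L2}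
    (hd : d ∈ σ.subCrossed ⊤) : ‖star d (vacuum Γ P)‖ ≤ ‖d (vacuum Γ P)‖ := by
  have key : ∀ v, ‖⟪star d (vacuum Γ P), v⟫_ℂ‖ ≤ ‖v‖ * ‖d (vacuum Γ P)‖ := by
    intro v
    refine closure_minimal (s := _) (t := {v | ‖⟪star d (vacuum Γ P), v⟫_ℂ‖ ≤
      ‖v‖ * ‖d (vacuum Γ P)‖}) ?_ (isClosed_le (by fun_prop) (by fun_prop)) (σ.vacuum_cyclic v)
    rintro _ ⟨w, hw, rfl⟩
    obtain ⟨hwM, hw⟩ := σ.span_spec hw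
    have h1 : ⟪star d (vacuum Γ P), w (vacuum Γ P)⟫_ℂ =
        ⟪star w (vacuum Γ P), d (vacuum Γ P)⟫_ℂ := by
      rw [← hw d hd, ContinuousLinearMap.star_eq_adjoint, ContinuousLinearMap.adjoint_inner_left]
    have h2 : ‖star w (vacuum Γ P)‖ = ‖w (vacuum Γ P)‖ := by
      have := hw (star w) (star_mem hwM)
      rw [inner_self_eq_norm_sq_to_K, ContinuousLinearMap.star_eq_adjoint,
        ContinuousLinearMap.adjoint_inner_right, inner_self_eq_norm_sq_to_K] at this
      have h3 : ‖w (vacuum Γ P)‖ ^ 2 = ‖star w (vacuum Γ P)‖ ^ 2 := by exact_mod_cast this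
      exact ((sq_eq_sq₀ (norm_nonneg _) (norm_nonneg _)).1 h3).symm
    change ‖⟪star d (vacuum Γ P), w (vacuum Γ P)⟫_ℂ‖ ≤ ‖w (vacuum Γ P)‖ * _
    rw [h1, ← h2]
    exact norm_inner_le_norm _ _
  have h := key (star d (vacuum Γ P))
  rw [inner_self_eq_norm_sq_to_K] at h
  have h' : ‖((‖star d (vacuum Γ P)‖ : ℝ) : ℂ) ^ 2‖ = ‖star d (vacuum Γ P)‖ ^ 2 := by simp
  have h2 := h'.symm.trans_le h
  by_contra hlt
  push Not at hlt
  have := (norm_nonneg (d (vacuum Γ P))).trans_lt hlt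
  nlinarith

theorem norm_star_apply_vacuum {d : EllTwo Γ P.L2 →L[ℂ] EllTwo Γ P.L2}
    (hd : d ∈ σ.subCrossed ⊤) : ‖star d (vacuum Γ P)‖ = ‖d (vacuum Γ P)‖ :=
  (σ.norm_star_apply_vacuum_le hd).antisymm
    (by simpa using σ.norm_star_apply_vacuum_le (star_mem hd))

/-- The vector state of `Ω` is a trace on `P ⋊ Γ`. -/
theorem inner_vacuum_comm {x y : EllTwo Γ P.L2 →L[ℂ] EllTwo Γ P.L2}
    (hx : x ∈ σ.subCrossed ⊤) (hy : y ∈ σ.subCrossed ⊤) :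
    ⟪vacuum Γ P, x (y (vacuum Γ P))⟫_ℂ = ⟪vacuum Γ P, y (x (vacuum Γ P))⟫_ℂ := by
  have sm : ∀ (c : ℂ) {z : EllTwo Γ P.L2 →L[ℂ] EllTwo Γ P.L2},
      z ∈ σ.subCrossed ⊤ → c • z ∈ σ.subCrossed (⊤ : Subgroup Γ) := fun c z hz =>
    (σ.subCrossed ⊤).toStarSubalgebra.smul_mem hz c
  have hI : ∀ v : EllTwo Γ P.L2, ‖Complex.I • v‖ = ‖v‖ := fun v => by simp [norm_smul]
  have h1 := σ.norm_star_apply_vacuum (add_mem hx (star_mem hy))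
  have h2 := σ.norm_star_apply_vacuum (sub_mem hx (star_mem hy))
  have h3 := σ.norm_star_apply_vacuum (add_mem hx (sm Complex.I (star_mem hy)))
  have h4 := σ.norm_star_apply_vacuum (sub_mem hx (sm Complex.I (star_mem hy)))
  have e1 : ⟪vacuum Γ P, x (y (vacuum Γ P))⟫_ℂ = ⟪star x (vacuum Γ P), y (vacuum Γ P)⟫_ℂ := by
    rw [ContinuousLinearMap.star_eq_adjoint, ContinuousLinearMap.adjoint_inner_left]
  have e2 : ⟪vacuum Γ P, y (x (vacuum Γ P))⟫_ℂ = ⟪star y (vacuum Γ P), x (vacuum Γ P)⟫_ℂ := by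
    rw [ContinuousLinearMap.star_eq_adjoint, ContinuousLinearMap.adjoint_inner_left]
  rw [e1, e2, inner_eq_sum_norm_sq_div_four, inner_eq_sum_norm_sq_div_four]
  set Ω := vacuum Γ P
  have g1 : ‖star x Ω + y Ω‖ = ‖star y Ω + x Ω‖ := by
    rw [add_comm (star y Ω)]
    simpa using h1
  have g2 : ‖star x Ω - y Ω‖ = ‖star y Ω - x Ω‖ := by
    rw [norm_sub_rev (star y Ω)]
    simpa using h2
  have g3 : ‖star x Ω - Complex.I • y Ω‖ = ‖star y Ω - Complex.I • x Ω‖ := by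
    rw [← hI (star y Ω - _), smul_sub, smul_smul, Complex.I_mul_I, neg_one_smul, sub_neg_eq_add,
      add_comm (Complex.I • _)]
    simpa [sub_eq_add_neg] using h3
  have g4 : ‖star x Ω + Complex.I • y Ω‖ = ‖star y Ω + Complex.I • x Ω‖ := by
    rw [← hI (star y Ω + _), smul_add, smul_smul, Complex.I_mul_I, neg_one_smul,
      ← sub_eq_add_neg, norm_sub_rev (Complex.I • _)]
    simpa [sub_eq_add_neg] using h4
  simp only [RCLike.I_to_complex, g1, g2, g3, g4]

theorem inner_vacuum_self : ⟪vacuum Γ P, vacuum Γ P⟫_ℂ = 1 := by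
  have h := lp.hasSum_inner (𝕜 := ℂ) (vacuum Γ P) (vacuum Γ P)
  rw [← h.tsum_eq, tsum_eq_single 1 fun s hs => by simp [vacuum, delta_ne hs]]
  rw [vacuum, delta_self, P.inner_hat, star_one, one_mul, P.trace_one]

/-- The crossed product `M = P ⋊ Γ` with its canonical trace `τ(x) = ⟪Ω, x Ω⟫`. -/
def crossedProduct : TracialVNA (EllTwo Γ P.L2) where
  alg := σ.subCrossed ⊤
  trace :=
    { toFun := fun x => ⟪vacuum Γ P, (x : EllTwo Γ P.L2 →L[ℂ] EllTwo Γ P.L2) (vacuum Γ P)⟫_ℂ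
      map_add' := fun x y => by simp
      map_smul' := fun c x => by simp }
  trace_one := inner_vacuum_self
  trace_nonneg := fun x => by
    change 0 ≤ ⟪vacuum Γ P, star x.1 (x.1 (vacuum Γ P))⟫_ℂ
    rw [ContinuousLinearMap.star_eq_adjoint, ContinuousLinearMap.adjoint_inner_right,
      inner_self_eq_norm_sq_to_K]
    have h : (0 : ℝ) ≤ ‖x.1 (vacuum Γ P)‖ ^ 2 := sq_nonneg _
    have h' := Complex.zero_le_real.2 h
    rwa [Complex.ofReal_pow] at h'
  faithful := fun x hx => by
    change ⟪vacuum Γ P, star x.1 (x.1 (vacuum Γ P))⟫_ℂ = 0 at hx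
    rw [ContinuousLinearMap.star_eq_adjoint, ContinuousLinearMap.adjoint_inner_right,
      inner_self_eq_zero] at hx
    exact Subtype.ext (σ.eq_zero_of_apply_vacuum x.2 hx)
  tracial := fun x y => σ.inner_vacuum_comm x.2 y.2
  normal := by
    refine ⟨Pi.single 0 (vacuum Γ P), Pi.single 0 (vacuum Γ P), ?_, ?_, fun x => ?_⟩
    · exact (hasSum_single 0 fun i hi => by simp [hi]).summable
    · exact (hasSum_single 0 fun i hi => by simp [hi]).summable
    · have := hasSum_single (f := fun i : ℕ => ⟪(Pi.single 0 (vacuum Γ P) : ℕ → EllTwo Γ P.L2) i,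
        x.1 ((Pi.single 0 (vacuum Γ P) : ℕ → EllTwo Γ P.L2) i)⟫_ℂ) 0 fun i hi => by simp [hi]
      simpa using this

/-- The canonical unitaries, as elements of `P ⋊ Γ`. -/
def uElt (g : Γ) : σ.crossedProduct.Elt := ⟨u g, σ.u_mem (Subgroup.mem_top g)⟩

end TracePreservingAction

/-! ## Bimodules in `L²(M)` -/

/-- An `N`-`N`-subbimodule of `L²(M)`: a closed subspace which is invariant under left and right
multiplication by elements of `N`. -/
structure L2Subbimodule {H : Type u} [NormedAddCommGroup H] [InnerProductSpace ℂ H]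
    [CompleteSpace H] (M : TracialVNA H) (N : VonNeumannAlgebra H) where
  carrier : Submodule ℂ M.L2
  isClosed : IsClosed (carrier : Set M.L2)
  left_mem : ∀ x : M.Elt, x.1 ∈ N → ∀ ξ ∈ carrier, M.leftMul x ξ ∈ carrier
  right_mem : ∀ x : M.Elt, x.1 ∈ N → ∀ ξ ∈ carrier, M.rightMul x ξ ∈ carrier

namespace L2Subbimodule

variable {H : Type u} [NormedAddCommGroup H] [InnerProductSpace ℂ H] [CompleteSpace H]
  {M : TracialVNA H} {N : VonNeumannAlgebra H}

/-- A bimodule is irreducible if it is nonzero and has no subbimodules besides `0` and itself. -/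
def IsIrreducible (K : L2Subbimodule M N) : Prop :=
  K.carrier ≠ ⊥ ∧
    ∀ L : L2Subbimodule M N, L.carrier ≤ K.carrier → L.carrier = ⊥ ∨ L.carrier = K.carrier

/-- Two bimodules are isomorphic if there is a unitary between them which intertwines the left
and the right actions of `N`. -/
def Iso (K L : L2Subbimodule M N) : Prop :=
  ∃ U : K.carrier ≃ₗᵢ[ℂ] L.carrier, ∀ (x : M.Elt) (hx : x.1 ∈ N) (ξ : K.carrier),
    (U ⟨M.leftMul x ξ, K.left_mem x hx ξ ξ.2⟩ : M.L2) = M.leftMul x (U ξ) ∧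
    (U ⟨M.rightMul x ξ, K.right_mem x hx ξ ξ.2⟩ : M.L2) = M.rightMul x (U ξ)

theorem closure_invariant (S : Set M.L2) (f : M.L2 →L[ℂ] M.L2) (h : ∀ ξ ∈ S, f ξ ∈ S)
    (ξ : M.L2) (hξ : ξ ∈ (Submodule.span ℂ S).topologicalClosure) :
    f ξ ∈ (Submodule.span ℂ S).topologicalClosure := by
  have h1 : Set.MapsTo f (Submodule.span ℂ S) (Submodule.span ℂ S) := fun η hη => by
    have : Submodule.span ℂ S ≤ (Submodule.span ℂ S).comap f.toLinearMap :=
      Submodule.span_le.2 fun ζ hζ => Submodule.subset_span (h ζ hζ)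
    exact this hη
  exact h1.closure f.continuous hξ

/-- The bimodule generated by `w ∈ M`: the closed linear span of `N w N` in `L²(M)`. -/
def closedSpan (N : VonNeumannAlgebra H) (w : M.Elt) : L2Subbimodule M N where
  carrier := (Submodule.span ℂ
    {ξ | ∃ x y : M.Elt, x.1 ∈ N ∧ y.1 ∈ N ∧ ξ = M.hat (x * w * y)}).topologicalClosure
  isClosed := Submodule.isClosed_topologicalClosure _
  left_mem := fun z hz ξ hξ => closure_invariant _ _ (by
    rintro _ ⟨x, y, hx, hy, rfl⟩
    exact ⟨z * x, y, mul_mem hz hx, hy, by simp [mul_assoc]⟩) ξ hξ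
  right_mem := fun z hz ξ hξ => closure_invariant _ _ (by
    rintro _ ⟨x, y, hx, hy, rfl⟩
    exact ⟨x, y * z, hx, mul_mem hy hz, by simp [mul_assoc]⟩) ξ hξ

end L2Subbimodule

/-! ## Baumslag-Solitar groups -/

/-- The relator `b aⁿ b⁻¹ a⁻ᵐ`, where `a` and `b` are the free generators indexed by `0` and `1`. -/
def baumslagSolitarRelator (n m : ℤ) : FreeGroup (Fin 2) :=
  FreeGroup.of 1 * FreeGroup.of 0 ^ n * (FreeGroup.of 1)⁻¹ * (FreeGroup.of 0 ^ m)⁻¹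

/-- The Baumslag-Solitar group `BS(n, m) = ⟨a, b | b aⁿ b⁻¹ = aᵐ⟩`. -/
abbrev BaumslagSolitar (n m : ℤ) : Type := PresentedGroup {baumslagSolitarRelator n m}

namespace BaumslagSolitar

/-- The generator `a` of `BS(n, m)`. -/
def a (n m : ℤ) : BaumslagSolitar n m := PresentedGroup.of 0

/-- The left index `l(g) = [⟨a⟩ : ⟨a⟩ ∩ g⁻¹⟨a⟩g]`. -/
def l {n m : ℤ} (g : BaumslagSolitar n m) : ℕ :=
  ((Subgroup.zpowers (a n m)).map (MulAut.conj g⁻¹).toMonoidHom).relIndex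
    (Subgroup.zpowers (a n m))

end BaumslagSolitar

end

/-!
Let `A` be an irreducible subalgebra of `M` and let `η ∈ L²(M)` be central for `A`. The elements of
`M` of bounded operator norm near `η` form a convex set which is closed in `L²(M)` and invariant
under conjugation by the unitaries of `A`, so its point of minimal norm commutes with `A` and hence
is a scalar. Thus `η` is a limit of scalars, so itself a scalar.

If `f` is an `N`-bimodule map on the bimodule generated by a unitary `w` and `A ⊆ N ∩ w*Nw`, then
`w* f(ŵ)` is central for `A`, and therefore `f(ŵ)` is a multiple of `ŵ`. Orthogonal projections onto
subbimodules then give irreducibility, and an isomorphism between the bimodules of `u_g` and `u_h`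
forces `û_g` into the bimodule of `u_h`. The latter is supported on the double coset of `h`.
-/

open Filter Topology

/-- The witness is the point of minimal norm. -/
theorem exists_mem_forall_fixed_of_norm_le {E : Type*} [NormedAddCommGroup E]
    [InnerProductSpace ℝ E] [CompleteSpace E] {C : Set E} (hne : C.Nonempty) (hcl : IsClosed C)
    (hconv : Convex ℝ C) :
    ∃ v ∈ C, ∀ f : E → E, Set.MapsTo f C C → (∀ z, ‖f z‖ ≤ ‖z‖) → f v = v := by
  obtain ⟨v, hv, hmin⟩ := exists_norm_eq_iInf_of_complete_convex hne hcl.isComplete hconv 0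
  refine ⟨v, hv, fun f hf hle => ?_⟩
  have hinner : ⟪0 - v, f v - v⟫_ℝ ≤ 0 :=
    (norm_eq_iInf_iff_real_inner_le_zero hconv hv).1 hmin _ (hf hv)
  have hnorm : ‖f v‖ ^ 2 ≤ ‖v‖ ^ 2 := pow_le_pow_left₀ (norm_nonneg _) (hle v) 2
  have hdist : ‖f v - v‖ ^ 2 ≤ 0 := by
    rw [zero_sub, inner_neg_left, inner_sub_right, real_inner_self_eq_norm_sq] at hinner
    rw [norm_sub_sq_real, real_inner_comm]
    linarith
  exact sub_eq_zero.1 (norm_eq_zero.1 (pow_eq_zero_iff two_ne_zero |>.1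
    (hdist.antisymm (sq_nonneg _))))

section Operators

variable {H : Type*} [NormedAddCommGroup H] [InnerProductSpace ℂ H]

theorem starProjection_apply_comm [CompleteSpace H] (L : Submodule ℂ H)
    [L.HasOrthogonalProjection] {f : H →L[ℂ] H} (hf : ∀ ξ ∈ L, f ξ ∈ L)
    (hf' : ∀ ξ ∈ L, star f ξ ∈ L) (ξ : H) :
    L.starProjection (f ξ) = f (L.starProjection ξ) := by
  refine L.eq_starProjection_of_mem_of_inner_eq_zero
    (hf _ (L.starProjection_apply_mem ξ)) fun w hw => ?_
  rw [← map_sub, ← ContinuousLinearMap.adjoint_inner_right, ← ContinuousLinearMap.star_eq_adjoint]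
  exact L.starProjection_inner_eq_zero ξ _ (hf' w hw)

variable {ι : Type*} {F : Ultrafilter ι} {x : ι → H →L[ℂ] H} {t : H →L[ℂ] H}

theorem exists_tendsto_inner_apply (F : Ultrafilter ι) {r : ℝ} (hx : ∀ i, ‖x i‖ ≤ r) (ξ η : H) :
    ∃ b : ℂ, ‖b‖ ≤ r * ‖ξ‖ * ‖η‖ ∧ Tendsto (fun i => ⟪x i ξ, η⟫_ℂ) F (𝓝 b) := by
  have hmem : ∀ i, ⟪x i ξ, η⟫_ℂ ∈ Metric.closedBall (0 : ℂ) (r * ‖ξ‖ * ‖η‖) := fun i =>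
    mem_closedBall_zero_iff.2 <| (norm_inner_le_norm _ _).trans <|
      mul_le_mul_of_nonneg_right ((x i).le_of_opNorm_le (hx i) ξ) (norm_nonneg η)
  obtain ⟨b, hb, hlim⟩ := (isCompact_closedBall _ _).ultrafilter_le_nhds
    (F.map fun i => ⟪x i ξ, η⟫_ℂ) (tendsto_principal.2 (.of_forall hmem))
  exact ⟨b, mem_closedBall_zero_iff.1 hb, hlim⟩

theorem exists_tendsto_inner_of_norm_le [CompleteSpace H] (F : Ultrafilter ι) {r : ℝ}
    (hx : ∀ i, ‖x i‖ ≤ r) :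
    ∃ t : H →L[ℂ] H, ‖t‖ ≤ r ∧ ∀ ξ η, Tendsto (fun i => ⟪x i ξ, η⟫_ℂ) F (𝓝 ⟪t ξ, η⟫_ℂ) := by
  choose b hb hlim using exists_tendsto_inner_apply F hx
  let B : H →L⋆[ℂ] H →L[ℂ] ℂ := LinearMap.mkContinuous₂ (LinearMap.mk₂'ₛₗ _ _ b
    (fun ξ ξ' η => tendsto_nhds_unique (hlim (ξ + ξ') η)
      (by simpa [inner_add_left] using (hlim ξ η).add (hlim ξ' η)))
    (fun c ξ η => tendsto_nhds_unique (hlim (c • ξ) η)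
      (by simpa [inner_smul_left, mul_comm] using (hlim ξ η).const_mul (starRingEnd ℂ c)))
    (fun ξ η η' => tendsto_nhds_unique (hlim ξ (η + η'))
      (by simpa [inner_add_right] using (hlim ξ η).add (hlim ξ η')))
    (fun c ξ η => tendsto_nhds_unique (hlim ξ (c • η))
      (by simpa [inner_smul_right] using (hlim ξ η).const_mul c))) r hb
  have hB : ∀ ξ η, ⟪InnerProductSpace.continuousLinearMapOfBilin B ξ, η⟫_ℂ = b ξ η :=
    InnerProductSpace.continuousLinearMapOfBilin_apply B
  refine ⟨InnerProductSpace.continuousLinearMapOfBilin B, ?_, fun ξ η => hB ξ η ▸ hlim ξ η⟩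
  have hr : 0 ≤ r := F.neBot.nonempty_of_mem F.univ_sets |>.elim fun i _ =>
    (norm_nonneg _).trans (hx i)
  refine ContinuousLinearMap.opNorm_le_of_re_inner_le hr fun ξ η hξ hη => ?_
  rw [hB]
  simpa [hξ, hη] using (Complex.re_le_norm _).trans (hb ξ η)

theorem mem_of_tendsto_inner [CompleteSpace H] {A : VonNeumannAlgebra H} (hx : ∀ i, x i ∈ A)
    (ht : ∀ ξ η, Tendsto (fun i => ⟪x i ξ, η⟫_ℂ) F (𝓝 ⟪t ξ, η⟫_ℂ)) : t ∈ A := by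
  rw [← A.commutant_commutant, VonNeumannAlgebra.mem_commutant_iff]
  intro g hg
  refine ContinuousLinearMap.ext fun ξ => ext_inner_right ℂ fun η => ?_
  refine tendsto_nhds_unique (f := fun i => ⟪x i (g ξ), η⟫_ℂ) (l := F) ?_ (ht (g ξ) η)
  have hcomm : ∀ i, x i * g = g * x i := fun i => VonNeumannAlgebra.mem_commutant_iff.1 hg _ (hx i)
  have h := ht ξ (g.adjoint η)
  simp only [ContinuousLinearMap.adjoint_inner_right] at h
  exact h.congr fun i => by rw [← mul_apply_eq_comp, ← hcomm]; rfl

end Operators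

section VonNeumann

variable {H : Type*} [NormedAddCommGroup H] [InnerProductSpace ℂ H] [CompleteSpace H]
  {A B C : VonNeumannAlgebra H}

theorem isIrreducibleIn_mono_left (hA : A.IsIrreducibleIn C) (hAB : A ≤ B) (hBC : B ≤ C) :
    B.IsIrreducibleIn C :=
  ⟨hBC, fun x hx h => hA.2 x hx fun a ha => h a (hAB ha)⟩

theorem conj_mem_of_mem_generatedBy {S : Set (H →L[ℂ] H)} {v : H →L[ℂ] H}
    (hv : v ∈ unitary (H →L[ℂ] H)) (hS : ∀ s ∈ S, v * s * star v ∈ B) {x : H →L[ℂ] H}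
    (hx : x ∈ VonNeumannAlgebra.generatedBy S) : v * x * star v ∈ B := by
  have hv₁ : star v * v = 1 := Unitary.star_mul_self_of_mem hv
  have hv₂ : v * star v = 1 := Unitary.mul_star_self_of_mem hv
  rw [← B.commutant_commutant, VonNeumannAlgebra.mem_commutant_iff]
  intro b hb
  have hcomm : ∀ s, v * s * star v ∈ B → s * (star v * b * v) = star v * b * v * s := by
    intro s hs
    have hbs : v * s * star v * b = b * (v * s * star v) :=
      VonNeumannAlgebra.mem_commutant_iff.1 hb _ hs
    calc s * (star v * b * v) = star v * v * s * star v * b * v := by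
          rw [hv₁, one_mul]; simp only [mul_assoc]
      _ = star v * (v * s * star v * b) * v := by simp only [mul_assoc]
      _ = star v * b * v * s * (star v * v) := by rw [hbs]; simp only [mul_assoc]
      _ = star v * b * v * s := by rw [hv₁, mul_one]
  have hx' := VonNeumannAlgebra.mem_generatedBy_iff.1 hx (star v * b * v) fun s hs =>
    ⟨hcomm s (hS s hs), hcomm (star s) (by simpa [mul_assoc] using star_mem (hS s hs))⟩
  calc b * (v * x * star v) = v * star v * b * v * x * star v := by
        rw [hv₂, one_mul]; simp only [mul_assoc]
    _ = v * (star v * b * v * x) * star v := by simp only [mul_assoc]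
    _ = v * x * star v * b * (v * star v) := by rw [hx']; simp only [mul_assoc]
    _ = v * x * star v * b := by rw [hv₂, mul_one]

theorem mul_comm_of_forall_unitary {y : H →L[ℂ] H}
    (h : ∀ v ∈ A, v ∈ unitary (H →L[ℂ] H) → v * y = y * v) {x : H →L[ℂ] H} (hx : x ∈ A) :
    x * y = y * x := by
  have hclosed : IsClosed (A.toStarSubalgebra : Set (H →L[ℂ] H)) := by
    change IsClosed A.carrier
    rw [← A.centralizer_centralizer']
    exact Set.isClosed_centralizer _
  have hspan : (⟨x, hx⟩ : A.toStarSubalgebra) ∈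
      Submodule.span ℂ (unitary A.toStarSubalgebra : Set A.toStarSubalgebra) := by
    rw [CStarAlgebra.span_unitary]
    trivial
  suffices ∀ z : A.toStarSubalgebra, z ∈
      Submodule.span ℂ (unitary A.toStarSubalgebra : Set A.toStarSubalgebra) →
      (z : H →L[ℂ] H) * y = y * z from this _ hspan
  intro z hz
  induction hz using Submodule.span_induction with
  | mem z hz =>
    exact h z z.2 (Unitary.map_mem A.toStarSubalgebra.subtype hz)
  | zero => simp
  | add z w _ _ hz hw => simp [add_mul, mul_add, hz, hw]
  | smul c z _ hz => simp [hz]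

end VonNeumann

namespace TracialVNA

variable {H : Type u} [NormedAddCommGroup H] [InnerProductSpace ℂ H] [CompleteSpace H]
variable (T : TracialVNA H)

/-- The map `x ↦ x̂` as a linear map. -/
noncomputable def hatLinear : T.Elt →ₗ[ℂ] T.L2 where
  toFun := T.hat
  map_add' x y := by simp [hat, UniformSpace.Completion.coe_add]
  map_smul' c x := by simp [hat, UniformSpace.Completion.coe_smul]

theorem hat_injective : Function.Injective T.hat :=
  (UniformSpace.Completion.coe_injective _).comp T.toPreL2.injective

theorem hat_smul (c : ℂ) (x : T.Elt) : T.hat (c • x) = c • T.hat x := map_smul T.hatLinear c x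

theorem hat_ne_zero_of_mem_unitary {v : T.Elt} (hv : v ∈ unitary T.Elt) : T.hat v ≠ 0 := by
  rw [← inner_self_ne_zero (𝕜 := ℂ), inner_hat, Unitary.star_mul_self_of_mem hv, trace_one]
  exact one_ne_zero

theorem leftMul_mul (x y : T.Elt) : T.leftMul (x * y) = T.leftMul x * T.leftMul y :=
  T.clm_ext fun z => by simp [mul_assoc]

theorem rightMul_mul (x y : T.Elt) : T.rightMul (x * y) = T.rightMul y * T.rightMul x :=
  T.clm_ext fun z => by simp [mul_assoc]

theorem rightMul_one : T.rightMul 1 = 1 := T.clm_ext fun x => by simp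

theorem leftMul_mem_unitary {v : T.Elt} (hv : v ∈ unitary T.Elt) :
    T.leftMul v ∈ unitary (T.L2 →L[ℂ] T.L2) := by
  simp only [Unitary.mem_iff, star_leftMul, ← leftMul_mul, Unitary.star_mul_self_of_mem hv,
    Unitary.mul_star_self_of_mem hv, leftMul_one, and_self]

theorem rightMul_mem_unitary {v : T.Elt} (hv : v ∈ unitary T.Elt) :
    T.rightMul v ∈ unitary (T.L2 →L[ℂ] T.L2) := by
  simp only [Unitary.mem_iff, star_rightMul, ← rightMul_mul, Unitary.star_mul_self_of_mem hv,
    Unitary.mul_star_self_of_mem hv, rightMul_one, and_self]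

variable {T} in
theorem tendsto_trace {ι : Type*} {F : Filter ι} {x : ι → T.Elt} {t : T.Elt} {r : ℝ}
    (hx : ∀ i, ‖x i‖ ≤ r)
    (ht : ∀ ξ η, Tendsto (fun i => ⟪(x i).1 ξ, η⟫_ℂ) F (𝓝 ⟪t.1 ξ, η⟫_ℂ)) :
    Tendsto (fun i => T.trace (x i)) F (𝓝 (T.trace t)) := by
  obtain ⟨ξ, η, hξ, hη, htrace⟩ := T.normal
  simp only [← (htrace _).tsum_eq]
  refine tendsto_tsum_of_dominated_convergence
    (bound := fun k => r * ((‖ξ k‖ ^ 2 + ‖η k‖ ^ 2) / 2))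
    (((hξ.add hη).div_const 2).mul_left r) (fun k => ?_)
    (Eventually.of_forall fun i k => ?_)
  · have h := (ht (ξ k) (η k)).star
    simpa only [← starRingEnd_apply, inner_conj_symm] using h
  · have hr : 0 ≤ r := (norm_nonneg _).trans (hx i)
    calc ‖⟪η k, (x i).1 (ξ k)⟫_ℂ‖ ≤ ‖η k‖ * (r * ‖ξ k‖) :=
          (norm_inner_le_norm _ _).trans <|
            mul_le_mul_of_nonneg_left ((x i).1.le_of_opNorm_le (hx i) _) (norm_nonneg _)
      _ = r * (‖ξ k‖ * ‖η k‖) := by ring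
      _ ≤ r * ((‖ξ k‖ ^ 2 + ‖η k‖ ^ 2) / 2) := by
          gcongr
          linarith [two_mul_le_add_sq ‖ξ k‖ ‖η k‖]

/-- The norm balls of `T` are compact for the weak operator topology, in which the trace is
continuous on them, so they have closed image in `L²(T, τ)`. -/
theorem isClosed_hat_closedBall (r : ℝ) : IsClosed (T.hat '' Metric.closedBall 0 r) := by
  refine IsSeqClosed.isClosed fun s ζ hs hζ => ?_
  choose x hx hxs using hs
  simp only [mem_closedBall_zero_iff] at hx
  obtain ⟨t, htr, ht⟩ := exists_tendsto_inner_of_norm_le (hyperfilter ℕ) (x := fun n => (x n).1) hx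
  have htT : t ∈ T.alg := mem_of_tendsto_inner (fun n => (x n).2) ht
  refine ⟨⟨t, htT⟩, mem_closedBall_zero_iff.2 htr, ?_⟩
  refine T.denseRange_hat.eq_of_inner_right ℂ fun y => ?_
  refine tendsto_nhds_unique (f := fun n => ⟪T.hat y, T.hat (x n)⟫_ℂ) (l := hyperfilter ℕ) ?_
    (tendsto_const_nhds.inner ((hζ.mono_left Nat.hyperfilter_le_atTop).congr fun n => (hxs n).symm))
  simp only [inner_hat]
  refine tendsto_trace (r := ‖star y‖ * r)
    (fun n => (norm_mul_le _ _).trans (mul_le_mul_of_nonneg_left (hx n) (norm_nonneg _)))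
    fun ξ η => ?_
  have hadj : ∀ z : T.Elt, ⟪(star y * z).1 ξ, η⟫_ℂ = ⟪z.1 ξ, y.1 η⟫_ℂ := fun z =>
    ContinuousLinearMap.adjoint_inner_left y.1 η (z.1 ξ)
  simpa only [hadj] using ht ξ (y.1 η)

theorem mapsTo_leftMul_comp_rightMul_star {v : T.Elt} (hv : v ∈ unitary T.Elt) {η : T.L2}
    (hvη : T.leftMul v η = T.rightMul v η) (r ε : ℝ) :
    Set.MapsTo (T.leftMul v ∘ T.rightMul (star v))
      (T.hat '' Metric.closedBall 0 r ∩ Metric.closedBall η ε)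
      (T.hat '' Metric.closedBall 0 r ∩ Metric.closedBall η ε) := by
  have hfix : T.leftMul v (T.rightMul (star v) η) = η := by
    rw [leftMul_rightMul_comm, hvη, ← mul_apply_eq_comp, ← rightMul_mul,
      Unitary.mul_star_self_of_mem hv, rightMul_one, one_apply_eq_self]
  rintro _ ⟨⟨y, hy, rfl⟩, hyη⟩
  refine ⟨⟨v * (y * star v), ?_, by simp⟩, ?_⟩
  · simpa [CStarRing.norm_mem_unitary_mul _ hv,
      CStarRing.norm_mul_mem_unitary _ (Unitary.star_mem hv)] using hy
  · rw [mem_closedBall_iff_norm] at hyη ⊢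
    rwa [Function.comp_apply, ← hfix, ← map_sub, ← map_sub,
      ContinuousLinearMap.norm_map_of_mem_unitary (T.leftMul_mem_unitary hv),
      ContinuousLinearMap.norm_map_of_mem_unitary (T.rightMul_mem_unitary (Unitary.star_mem hv))]

theorem exists_norm_sub_le_forall_unitary_comm (η : T.L2) {ε : ℝ} (hε : 0 < ε) :
    ∃ y : T.Elt, ‖T.hat y - η‖ ≤ ε ∧
      ∀ v ∈ unitary T.Elt, T.leftMul v η = T.rightMul v η → v * y = y * v := by
  let _ : InnerProductSpace ℝ T.L2 := InnerProductSpace.complexToReal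
  obtain ⟨x, hx⟩ := T.denseRange_hat.exists_dist_lt η hε
  have hconv : Convex ℝ (T.hat '' Metric.closedBall 0 ‖x‖) :=
    (convex_closedBall 0 _).linear_image (T.hatLinear.restrictScalars ℝ)
  obtain ⟨_, ⟨⟨y, -, rfl⟩, hyη⟩, hfix⟩ := exists_mem_forall_fixed_of_norm_le
    (C := T.hat '' Metric.closedBall 0 ‖x‖ ∩ Metric.closedBall η ε)
    ⟨T.hat x, ⟨x, by simp, rfl⟩, Metric.mem_closedBall'.2 hx.le⟩
    ((T.isClosed_hat_closedBall _).inter Metric.isClosed_closedBall)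
    (hconv.inter (convex_closedBall η ε))
  refine ⟨y, mem_closedBall_iff_norm.1 hyη, fun v hv hvη => ?_⟩
  have hconj := hfix _ (T.mapsTo_leftMul_comp_rightMul_star hv hvη _ _) fun ξ => by
    rw [Function.comp_apply, ContinuousLinearMap.norm_map_of_mem_unitary (T.leftMul_mem_unitary hv),
      ContinuousLinearMap.norm_map_of_mem_unitary (T.rightMul_mem_unitary (Unitary.star_mem hv))]
  simp only [Function.comp_apply, rightMul_hat, leftMul_hat] at hconj
  calc v * y = v * (y * star v) * v := by
        simp only [mul_assoc, Unitary.star_mul_self_of_mem hv, mul_one]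
    _ = y * v := by rw [T.hat_injective hconj]

theorem exists_eq_smul_hat_one {A : VonNeumannAlgebra H} (hA : A.IsIrreducibleIn T.alg) {η : T.L2}
    (hη : ∀ x : T.Elt, x.1 ∈ A → T.leftMul x η = T.rightMul x η) :
    ∃ c : ℂ, η = c • T.hat 1 := by
  suffices η ∈ ℂ ∙ T.hat 1 by
    obtain ⟨c, hc⟩ := Submodule.mem_span_singleton.1 this
    exact ⟨c, hc.symm⟩
  have hclosed : IsClosed (ℂ ∙ T.hat 1 : Set T.L2) := Submodule.closed_of_finiteDimensional _
  rw [← SetLike.mem_coe, ← hclosed.closure_eq, Metric.mem_closure_iff]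
  intro ε hε
  obtain ⟨y, hyη, hy⟩ := T.exists_norm_sub_le_forall_unitary_comm η (half_pos hε)
  have hyA : ∀ v ∈ A, v ∈ unitary (H →L[ℂ] H) → v * y.1 = y.1 * v := fun v hvA hv =>
    congrArg Subtype.val <| hy ⟨v, hA.1 hvA⟩
      (Unitary.mem_iff.2 ⟨Subtype.ext hv.1, Subtype.ext hv.2⟩) (hη _ hvA)
  obtain ⟨c, hc⟩ := hA.2 y.1 y.2 fun a ha => mul_comm_of_forall_unitary hyA ha
  have hyc : y = c • 1 := Subtype.ext hc
  refine ⟨T.hat y, Submodule.mem_span_singleton.2 ⟨c, by rw [hyc, hat_smul]⟩, ?_⟩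
  rw [dist_eq_norm, norm_sub_rev]
  exact hyη.trans_lt (half_lt_self hε)

end TracialVNA

namespace L2Subbimodule

variable {H : Type u} [NormedAddCommGroup H] [InnerProductSpace ℂ H] [CompleteSpace H]
  {M : TracialVNA H} {N : VonNeumannAlgebra H}

theorem carrier_injective :
    Function.Injective (carrier : L2Subbimodule M N → Submodule ℂ M.L2) := by
  rintro ⟨⟩ ⟨⟩ rfl
  rfl

theorem Iso.refl (K : L2Subbimodule M N) : K.Iso K :=
  ⟨LinearIsometryEquiv.refl ℂ _, fun _ _ _ => ⟨rfl, rfl⟩⟩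

theorem closedSpan_le {w : M.Elt} {L : L2Subbimodule M N} (hw : M.hat w ∈ L.carrier) :
    (closedSpan N w).carrier ≤ L.carrier := by
  refine Submodule.topologicalClosure_minimal _ (Submodule.span_le.2 ?_) L.isClosed
  rintro _ ⟨x, y, hx, hy, rfl⟩
  simpa using L.right_mem y hy _ (L.left_mem x hx _ hw)

theorem hat_mul_mem_closedSpan {w x y : M.Elt} (hx : x.1 ∈ N) (hy : y.1 ∈ N) :
    M.hat (x * w * y) ∈ (closedSpan N w).carrier :=
  Submodule.le_topologicalClosure _ (Submodule.subset_span ⟨x, y, hx, hy, rfl⟩)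

theorem hat_mem_closedSpan (w : M.Elt) : M.hat w ∈ (closedSpan N w).carrier := by
  simpa using hat_mul_mem_closedSpan (w := w) (x := 1) (y := 1) (one_mem N) (one_mem N)

/-- The orthogonal complement of a bimodule, with the restricted actions. -/
noncomputable def orthogonal (L : L2Subbimodule M N) : L2Subbimodule M N where
  carrier := L.carrierᗮ
  isClosed := Submodule.isClosed_orthogonal _
  left_mem x hx ξ hξ η hη := by
    rw [← ContinuousLinearMap.adjoint_inner_left, ← ContinuousLinearMap.star_eq_adjoint,
      M.star_leftMul]
    exact hξ _ (L.left_mem (star x) (star_mem hx) η hη)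
  right_mem x hx ξ hξ η hη := by
    rw [← ContinuousLinearMap.adjoint_inner_left, ← ContinuousLinearMap.star_eq_adjoint,
      M.star_rightMul]
    exact hξ _ (L.right_mem (star x) (star_mem hx) η hη)

/-- A linear map from a subbimodule of `L²(M)` to `L²(M)` is a bimodule map if it intertwines the
left and the right actions of `N`. -/
def IsBimoduleMap (K : L2Subbimodule M N) (f : K.carrier →ₗ[ℂ] M.L2) : Prop :=
  ∀ (x : M.Elt) (hx : x.1 ∈ N) (ξ : K.carrier),
    f ⟨M.leftMul x ξ, K.left_mem x hx ξ ξ.2⟩ = M.leftMul x (f ξ) ∧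
    f ⟨M.rightMul x ξ, K.right_mem x hx ξ ξ.2⟩ = M.rightMul x (f ξ)

theorem isBimoduleMap_starProjection (K L : L2Subbimodule M N)
    [L.carrier.HasOrthogonalProjection] :
    K.IsBimoduleMap (L.carrier.starProjection.toLinearMap ∘ₗ K.carrier.subtype) := by
  refine fun x hx ξ => ⟨starProjection_apply_comm L.carrier (L.left_mem x hx) ?_ ξ,
    starProjection_apply_comm L.carrier (L.right_mem x hx) ?_ ξ⟩
  · rw [M.star_leftMul]
    exact L.left_mem (star x) (star_mem hx)
  · rw [M.star_rightMul]
    exact L.right_mem (star x) (star_mem hx)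

section IntertwiningUnitary

variable {A : VonNeumannAlgebra H} {w : M.Elt}

theorem IsBimoduleMap.leftMul_leftMul_star_eq {f : (closedSpan N w).carrier →ₗ[ℂ] M.L2}
    (hf : (closedSpan N w).IsBimoduleMap f) (hw : w ∈ unitary M.Elt) {x : M.Elt} (hx : x.1 ∈ N)
    (hwx : (w * x * star w).1 ∈ N) :
    M.leftMul x (M.leftMul (star w) (f ⟨M.hat w, hat_mem_closedSpan w⟩)) =
      M.rightMul x (M.leftMul (star w) (f ⟨M.hat w, hat_mem_closedSpan w⟩)) := by
  have hcomm : M.leftMul (w * x * star w) (f ⟨M.hat w, hat_mem_closedSpan w⟩) =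
      M.rightMul x (f ⟨M.hat w, hat_mem_closedSpan w⟩) := by
    rw [← (hf _ hwx _).1, ← (hf x hx _).2]
    congr 2
    simp only [TracialVNA.leftMul_hat, TracialVNA.rightMul_hat, mul_assoc,
      Unitary.star_mul_self_of_mem hw, mul_one]
  have hstar : x * star w = star w * (w * x * star w) := by
    simp only [← mul_assoc, Unitary.star_mul_self_of_mem hw, one_mul]
  rw [← mul_apply_eq_comp, ← M.leftMul_mul, hstar, M.leftMul_mul, mul_apply_eq_comp, hcomm,
    M.leftMul_rightMul_comm]

theorem IsBimoduleMap.exists_apply_hat_eq_smul {f : (closedSpan N w).carrier →ₗ[ℂ] M.L2}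
    (hf : (closedSpan N w).IsBimoduleMap f) (hw : w ∈ unitary M.Elt)
    (hA : A.IsIrreducibleIn M.alg) (hAN : A ≤ N)
    (hconj : ∀ x : M.Elt, x.1 ∈ A → (w * x * star w).1 ∈ N) :
    ∃ c : ℂ, f ⟨M.hat w, hat_mem_closedSpan w⟩ = c • M.hat w := by
  obtain ⟨c, hc⟩ := M.exists_eq_smul_hat_one hA fun x hx =>
    hf.leftMul_leftMul_star_eq hw (hAN hx) (hconj x hx)
  refine ⟨c, ?_⟩
  have h := congrArg (M.leftMul w) hc
  rwa [← mul_apply_eq_comp, ← M.leftMul_mul, Unitary.mul_star_self_of_mem hw, M.leftMul_one,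
    one_apply_eq_self, map_smul, M.leftMul_hat, mul_one] at h

theorem isIrreducible_closedSpan (hw : w ∈ unitary M.Elt) (hA : A.IsIrreducibleIn M.alg)
    (hAN : A ≤ N) (hconj : ∀ x : M.Elt, x.1 ∈ A → (w * x * star w).1 ∈ N) :
    (closedSpan N w).IsIrreducible := by
  refine ⟨fun hbot => M.hat_ne_zero_of_mem_unitary hw ?_, fun L hL => ?_⟩
  · simpa [hbot] using hat_mem_closedSpan (N := N) w
  have : CompleteSpace L.carrier := L.isClosed.completeSpace_coe
  obtain ⟨c, hc⟩ := (isBimoduleMap_starProjection (closedSpan N w) L).exists_apply_hat_eq_smul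
    hw hA hAN hconj
  change L.carrier.starProjection (M.hat w) = c • M.hat w at hc
  rcases eq_or_ne c 0 with rfl | hc0
  · rw [zero_smul, Submodule.starProjection_apply_eq_zero_iff] at hc
    exact .inl (Submodule.isOrtho_self.1 (hL.trans (closedSpan_le (L := L.orthogonal) hc)))
  · have hmem := L.carrier.starProjection_apply_mem (M.hat w)
    rw [hc, Submodule.smul_mem_iff _ hc0] at hmem
    exact .inr (hL.antisymm (closedSpan_le hmem))

theorem Iso.hat_mem {L : L2Subbimodule M N} (hL : (closedSpan N w).Iso L)
    (hw : w ∈ unitary M.Elt) (hA : A.IsIrreducibleIn M.alg) (hAN : A ≤ N)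
    (hconj : ∀ x : M.Elt, x.1 ∈ A → (w * x * star w).1 ∈ N) : M.hat w ∈ L.carrier := by
  obtain ⟨U, hU⟩ := hL
  have hbimod : (closedSpan N w).IsBimoduleMap
      (L.carrier.subtype ∘ₗ U.toLinearEquiv.toLinearMap) := hU
  obtain ⟨c, hc⟩ := hbimod.exists_apply_hat_eq_smul hw hA hAN hconj
  change (U ⟨M.hat w, hat_mem_closedSpan w⟩ : M.L2) = c • M.hat w at hc
  have hmem := (U ⟨M.hat w, hat_mem_closedSpan w⟩).2
  rw [hc] at hmem
  refine (Submodule.smul_mem_iff _ fun hc0 => M.hat_ne_zero_of_mem_unitary hw ?_).1 hmem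
  rw [hc0, zero_smul, Submodule.coe_eq_zero, map_eq_zero_iff _ U.injective] at hc
  exact congrArg Subtype.val hc

end IntertwiningUnitary

end L2Subbimodule

namespace EllTwo

variable {Γ : Type v} {E : Type u} [NormedAddCommGroup E]

theorem support_delta_subset (s : Γ) (v : E) : Function.support (delta s v : EllTwo Γ E) ⊆ {s} :=
  Function.support_subset_iff'.2 fun _ ht => delta_ne ht v

variable [InnerProductSpace ℂ E]

theorem inner_delta_left (s : Γ) (v : E) (ξ : EllTwo Γ E) : ⟪delta s v, ξ⟫_ℂ = ⟪v, ξ s⟫_ℂ := by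
  rw [lp.inner_eq_tsum, tsum_eq_single s fun t ht => by rw [delta_ne ht, inner_zero_left],
    delta_self]

open Classical in
/-- The orthogonal projection of `ℓ²(Γ, E)` onto the vectors supported on `S`. -/
noncomputable def restrict (S : Set Γ) : EllTwo Γ E →L[ℂ] EllTwo Γ E :=
  op (Equiv.refl Γ) (fun s => if s ∈ S then 1 else 0) 1 fun s => by
    split_ifs
    · exact ContinuousLinearMap.norm_id_le
    · simp

theorem restrict_apply_of_mem {S : Set Γ} {s : Γ} (hs : s ∈ S) (ξ : EllTwo Γ E) :
    restrict S ξ s = ξ s := by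
  simp [restrict, hs]

theorem restrict_apply_of_notMem {S : Set Γ} {s : Γ} (hs : s ∉ S) (ξ : EllTwo Γ E) :
    restrict S ξ s = 0 := by
  simp [restrict, hs]

theorem restrict_eq_self_iff {S : Set Γ} {ξ : EllTwo Γ E} :
    restrict S ξ = ξ ↔ Function.support ξ ⊆ S := by
  rw [Function.support_subset_iff']
  refine ⟨fun h s hs => by rw [← h, restrict_apply_of_notMem hs], fun h => ?_⟩
  ext s
  by_cases hs : s ∈ S
  · rw [restrict_apply_of_mem hs]
  · rw [restrict_apply_of_notMem hs, h s hs]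

end EllTwo

namespace TracePreservingAction

open EllTwo L2Subbimodule
open scoped Pointwise

variable {Γ : Type v} [Group Γ] {H : Type u} [NormedAddCommGroup H]
  [InnerProductSpace ℂ H] [CompleteSpace H] {P : TracialVNA H} (σ : TracePreservingAction Γ P)
  {Z : Subgroup Γ}

section CanonicalUnitaries

theorem u_mul (g h : Γ) : u (P := P) (g * h) = u g * u h := by
  ext ξ s
  simp [u]

theorem u_one : u (P := P) (1 : Γ) = 1 := by
  ext ξ s
  simp [u]

theorem u_mem_unitary (g : Γ) : u (P := P) g ∈ unitary (EllTwo Γ P.L2 →L[ℂ] EllTwo Γ P.L2) := by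
  rw [Unitary.mem_iff, star_u, ← u_mul, ← u_mul, inv_mul_cancel, mul_inv_cancel, u_one]
  exact ⟨rfl, rfl⟩

theorem uElt_mem_unitary (g : Γ) : σ.uElt g ∈ unitary σ.crossedProduct.Elt :=
  Unitary.mem_iff.2 ⟨Subtype.ext (u_mem_unitary g).1, Subtype.ext (u_mem_unitary g).2⟩

theorem uElt_mul (g h : Γ) : σ.uElt (g * h) = σ.uElt g * σ.uElt h := Subtype.ext (u_mul g h)

theorem u_mul_rep (g : Γ) (p : P.Elt) : u g * σ.rep p = σ.rep (σ.aut g p) * u g := by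
  ext ξ s
  simp [u, rep]

theorem conj_u_mem_subCrossed {g : Γ} {x : EllTwo Γ P.L2 →L[ℂ] EllTwo Γ P.L2}
    (hx : x ∈ σ.subCrossed (Z ⊓ Z.map (MulAut.conj g⁻¹).toMonoidHom)) :
    u g * x * star (u g) ∈ σ.subCrossed Z := by
  refine conj_mem_of_mem_generatedBy (u_mem_unitary g) ?_ hx
  rintro _ (⟨p, rfl⟩ | ⟨_, ⟨-, k, hk, rfl⟩, rfl⟩)
  · rw [u_mul_rep, mul_assoc, Unitary.mul_star_self_of_mem (u_mem_unitary g), mul_one]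
    exact σ.rep_mem Z _
  · rw [star_u, ← u_mul, ← u_mul]
    exact σ.u_mem (by simpa [mul_assoc] using hk)

end CanonicalUnitaries

section Support

theorem support_u_apply_subset (g : Γ) (ξ : EllTwo Γ P.L2) :
    Function.support (u g ξ) ⊆ {g} * Function.support ξ := fun s hs =>
  Set.mem_mul.2 ⟨g, rfl, g⁻¹ * s, hs, mul_inv_cancel_left g s⟩

theorem rep_mul_restrict (p : P.Elt) (S : Set Γ) :
    σ.rep p * restrict S = restrict S * σ.rep p := by
  ext ξ s
  by_cases hs : s ∈ S <;> simp [rep, restrict, hs]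

theorem u_mul_restrict {g : Γ} {S : Set Γ} (hS : ∀ s, g⁻¹ * s ∈ S ↔ s ∈ S) :
    u (P := P) g * restrict S = restrict S * u g := by
  ext ξ s
  by_cases hs : s ∈ S <;> simp [u, restrict, hS, hs]

theorem restrict_mul_comm {x : EllTwo Γ P.L2 →L[ℂ] EllTwo Γ P.L2} (hx : x ∈ σ.subCrossed Z)
    {S : Set Γ} (hS : ∀ k ∈ Z, ∀ s, k * s ∈ S ↔ s ∈ S) : restrict S * x = x * restrict S := by
  refine VonNeumannAlgebra.mem_generatedBy_iff.1 hx _ ?_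
  rintro _ (⟨p, rfl⟩ | ⟨k, hk, rfl⟩)
  · exact ⟨σ.rep_mul_restrict p S, by rw [star_rep, rep_mul_restrict]⟩
  · exact ⟨u_mul_restrict (hS _ (Z.inv_mem hk)), by
      rw [star_u, u_mul_restrict (by simpa using hS k hk)]⟩

theorem support_apply_subset {x : EllTwo Γ P.L2 →L[ℂ] EllTwo Γ P.L2} (hx : x ∈ σ.subCrossed Z)
    (ξ : EllTwo Γ P.L2) : Function.support (x ξ) ⊆ (Z : Set Γ) * Function.support ξ := by
  have hS : ∀ k ∈ Z, ∀ s, k * s ∈ (Z : Set Γ) * Function.support ξ ↔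
      s ∈ (Z : Set Γ) * Function.support ξ := fun k hk s => by
    rw [← smul_eq_mul k s, ← Set.mem_inv_smul_set_iff, ← smul_mul_assoc,
      smul_coe_set (Z.inv_mem hk)]
  have hξ : restrict ((Z : Set Γ) * Function.support ξ) ξ = ξ :=
    restrict_eq_self_iff.2 (Set.subset_mul_right _ Z.one_mem)
  rw [← restrict_eq_self_iff, ← mul_apply_eq_comp, σ.restrict_mul_comm hx hS, mul_apply_eq_comp, hξ]

theorem inner_hat_crossedProduct (x y : σ.crossedProduct.Elt) :
    ⟪σ.crossedProduct.hat x, σ.crossedProduct.hat y⟫_ℂ =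
      ⟪x.1 (vacuum Γ P), y.1 (vacuum Γ P)⟫_ℂ := by
  rw [TracialVNA.inner_hat, ← ContinuousLinearMap.adjoint_inner_right]
  rfl

theorem inner_hat_uElt_eq_zero {g h : Γ} (hgh : g ∉ DoubleCoset.doubleCoset h (Z : Set Γ) Z)
    {x y : σ.crossedProduct.Elt} (hx : x.1 ∈ σ.subCrossed Z) (hy : y.1 ∈ σ.subCrossed Z) :
    ⟪σ.crossedProduct.hat (σ.uElt g), σ.crossedProduct.hat (x * σ.uElt h * y)⟫_ℂ = 0 := by
  have hsupp : Function.support ((x * σ.uElt h * y).1 (vacuum Γ P)) ⊆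
      DoubleCoset.doubleCoset h (Z : Set Γ) Z :=
    calc Function.support (x.1 (u h (y.1 (vacuum Γ P))))
      _ ⊆ (Z : Set Γ) * ({h} * (Z * {1})) :=
        (σ.support_apply_subset hx _).trans <| Set.mul_subset_mul_left <|
          (support_u_apply_subset h _).trans <| Set.mul_subset_mul_left <|
            (σ.support_apply_subset hy _).trans <| Set.mul_subset_mul_left <|
              support_delta_subset 1 _
      _ = DoubleCoset.doubleCoset h (Z : Set Γ) Z := by
        rw [Set.singleton_one, mul_one, ← mul_assoc, DoubleCoset.doubleCoset]
  have hug : (σ.uElt g).1 (vacuum Γ P) = delta g (P.hat 1) := by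
    rw [vacuum, uElt, u_delta, mul_one]
  rw [inner_hat_crossedProduct, hug, inner_delta_left,
    Function.notMem_support.1 fun hg => hgh (hsupp hg), inner_zero_right]

end Support

theorem mem_doubleCoset_of_hat_mem_closedSpan {g h : Γ}
    (hg : σ.crossedProduct.hat (σ.uElt g) ∈ (closedSpan (σ.subCrossed Z) (σ.uElt h)).carrier) :
    g ∈ DoubleCoset.doubleCoset h (Z : Set Γ) Z := by
  by_contra hgh
  have hort : (closedSpan (σ.subCrossed Z) (σ.uElt h)).carrier ≤
      (ℂ ∙ σ.crossedProduct.hat (σ.uElt g))ᗮ := by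
    refine Submodule.topologicalClosure_minimal _ (Submodule.span_le.2 ?_)
      (Submodule.isClosed_orthogonal _)
    rintro _ ⟨x, y, hx, hy, rfl⟩
    exact Submodule.mem_orthogonal_singleton_iff_inner_right.2 (σ.inner_hat_uElt_eq_zero hgh hx hy)
  exact TracialVNA.hat_ne_zero_of_mem_unitary _ (σ.uElt_mem_unitary g)
    (inner_self_eq_zero.1 (Submodule.mem_orthogonal_singleton_iff_inner_right.1 (hort hg)))

theorem closedSpan_uElt_le {g h : Γ} (hgh : g ∈ DoubleCoset.doubleCoset h (Z : Set Γ) Z) :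
    (closedSpan (σ.subCrossed Z) (σ.uElt g)).carrier ≤
      (closedSpan (σ.subCrossed Z) (σ.uElt h)).carrier := by
  obtain ⟨i, hi, j, hj, rfl⟩ := DoubleCoset.mem_doubleCoset.1 hgh
  refine closedSpan_le ?_
  rw [uElt_mul, uElt_mul]
  exact hat_mul_mem_closedSpan (σ.u_mem hi) (σ.u_mem hj)

theorem closedSpan_uElt_eq {g h : Γ} (hgh : DoubleCoset.doubleCoset g (Z : Set Γ) Z =
      DoubleCoset.doubleCoset h (Z : Set Γ) Z) :
    closedSpan (σ.subCrossed Z) (σ.uElt g) = closedSpan (σ.subCrossed Z) (σ.uElt h) :=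
  carrier_injective <| le_antisymm
    (σ.closedSpan_uElt_le (hgh ▸ DoubleCoset.mem_doubleCoset_self Z Z g))
    (σ.closedSpan_uElt_le (hgh ▸ DoubleCoset.mem_doubleCoset_self Z Z h))

end TracePreservingAction

theorem lemma4p1_general {Γ : Type*} [Group Γ] (Z : Subgroup Γ)
    {H : Type*} [NormedAddCommGroup H] [InnerProductSpace ℂ H] [CompleteSpace H]
    (P : TracialVNA H) (σ : TracePreservingAction Γ P)
    (hirr : ∀ g : Γ,
      (σ.subCrossed (Z ⊓ Z.map (MulAut.conj g⁻¹).toMonoidHom)).IsIrreducibleIn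
        σ.crossedProduct.alg) :
    (∀ g : Γ, (L2Subbimodule.closedSpan (σ.subCrossed Z) (σ.uElt g)).IsIrreducible) ∧
    ∀ g h : Γ, (L2Subbimodule.closedSpan (σ.subCrossed Z) (σ.uElt g)).Iso
        (L2Subbimodule.closedSpan (σ.subCrossed Z) (σ.uElt h)) ↔
      DoubleCoset.doubleCoset g (Z : Set Γ) Z = DoubleCoset.doubleCoset h Z Z := by
  refine ⟨fun g => L2Subbimodule.isIrreducible_closedSpan (σ.uElt_mem_unitary g) (hirr g)
    (σ.subCrossed_mono inf_le_left) fun x => σ.conj_u_mem_subCrossed, fun g h => ⟨fun hiso => ?_,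
    fun hgh => σ.closedSpan_uElt_eq hgh ▸ L2Subbimodule.Iso.refl _⟩⟩
  have hmem := hiso.hat_mem (σ.uElt_mem_unitary g) (hirr g) (σ.subCrossed_mono inf_le_left)
    fun x => σ.conj_u_mem_subCrossed
  exact DoubleCoset.doubleCoset_eq_of_mem (σ.mem_doubleCoset_of_hat_mem_closedSpan hmem)

/-- `l g` is the index of the right-hand side in `⟨a⟩`. -/
theorem BaumslagSolitar.zpowers_pow_l_le {n m : ℤ} (g : BaumslagSolitar n m) :
    Subgroup.zpowers (a n m ^ l g) ≤ Subgroup.zpowers (a n m) ⊓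
      (Subgroup.zpowers (a n m)).map (MulAut.conj g⁻¹).toMonoidHom :=
  Subgroup.zpowers_le.2 ⟨pow_mem (Subgroup.mem_zpowers _) _,
    (((Subgroup.zpowers (a n m)).map (MulAut.conj g⁻¹).toMonoidHom).subgroupOf
      (Subgroup.zpowers (a n m))).pow_index_mem ⟨a n m, Subgroup.mem_zpowers _⟩⟩

theorem lemma4p1 {n m : ℤ} (hn : 2 ≤ n) (hnm : n ≤ |m|)
    {H : Type*} [NormedAddCommGroup H] [InnerProductSpace ℂ H] [CompleteSpace H]
    (P : TracialVNA H) (σ : TracePreservingAction (BaumslagSolitar n m) P)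
    (hirr : ∀ g : BaumslagSolitar n m,
      (σ.subCrossed (Subgroup.zpowers (BaumslagSolitar.a n m ^ BaumslagSolitar.l g))).IsIrreducibleIn
        σ.crossedProduct.alg) :
    (∀ g : BaumslagSolitar n m,
      (L2Subbimodule.closedSpan (σ.subCrossed (Subgroup.zpowers (BaumslagSolitar.a n m)))
        (σ.uElt g)).IsIrreducible) ∧
    ∀ g h : BaumslagSolitar n m,
      (L2Subbimodule.closedSpan (σ.subCrossed (Subgroup.zpowers (BaumslagSolitar.a n m)))
        (σ.uElt g)).Iso
        (L2Subbimodule.closedSpan (σ.subCrossed (Subgroup.zpowers (BaumslagSolitar.a n m)))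
          (σ.uElt h)) ↔
      DoubleCoset.doubleCoset g (Subgroup.zpowers (BaumslagSolitar.a n m) : Set (BaumslagSolitar n m))
          (Subgroup.zpowers (BaumslagSolitar.a n m)) =
        DoubleCoset.doubleCoset h (Subgroup.zpowers (BaumslagSolitar.a n m))
          (Subgroup.zpowers (BaumslagSolitar.a n m)) :=
  lemma4p1_general _ P σ fun g => isIrreducibleIn_mono_left (hirr g)
    (σ.subCrossed_mono (BaumslagSolitar.zpowers_pow_l_le g)) (σ.subCrossed_mono le_top)
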